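/- Let $\Gamma$ be a group acting on $\mathbb R^m$ by isometries, with a relatively compact fundamental domain $F$ that contains the origin $0$ in its interior (the translates of $\overline F$ cover $\mathbb R^m$, and the translates of the interior of $F$ by distinct elements of $\Gamma$ are disjoint). Let $\Lambda\le\Gamma$ be a subgroup of finite index that acts by translations; then $\Lambda$ is identified with a lattice in $\mathbb R^m$, so that $\Gamma$ is virtually $\mathbb Z^m$. Write $\Phi(x)=x\cdot 0\in\mathbb R^m$ for $x\in\Gamma$. Let $\mathrm{vol}(\mathbb R^m/\Gamma):=\mathrm{vol}(\mathbb R^m/\Lambda)/[\Gamma:\Lambda]$, the covolume of $\Gamma$. Let $\mu$ be a probability measure on $\Gamma$ whose support $S$ is finite and generates $\Gamma$ as a semigroup, such that $\mu(s^{-1})=\mu(s)$ for all $s$, and $\mu(\mathrm{id})>0$. Let $\mu_n$ be the $n$-fold convolution power of $\mu$. Let $G$ be the quotient of the Cayley graph of $(\Gamma,S)$ by $\Lambda$: its vertices are the cosets $\Lambda x$, and its oriented edges are the pairs $e=(\Lambda x,s)$ with $s\in S$, going from $\Lambda x$ to $\Lambda xs$, with reversed edge $\bar e=(\Lambda xs,s^{-1})$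 and conductance $c(e)=\mu(s)/[\Gamma:\Lambda]$. A $1$-form is a function $\omega:E(G)\to\mathbb R$ on the oriented edges with $\omega(\bar e)=-\omega(e)$. It is harmonic if $\sum_{e}c(e)\omega(e)=0$ for every vertex $y$, the sum being over the edges $e$ with origin $y$. Every $1$-form $\omega$ has a unique harmonic part, i.e. a harmonic $1$-form $u$ such that, for some function $f$ on the vertices, $\omega(e)-u(e)=f(z)-f(y)$ for every edge $e$ from $y$ to $z$. For $v\in\mathbb R^m$ let $\hat v$ be the $1$-form $\hat v(\Lambda x,s)=\langle v,\Phi(xs)-\Phi(x)\rangle$. For a positive definite $m\times m$ matrix $\Sigma$ put $$\xi_\Sigma(x)=\frac{1}{(2\pi)^{m/2}\sqrt{\det\Sigma}}\,e^{-\frac12\langle\Phi(x),\Sigma^{-1}\Phi(x)\rangle}\qquad(x\in\Gamma).$$ **Theorem (local central limit theorem).** There are a positive definite matrix $\Sigma$ and a constant $C>0$ such that $$\sup_{x\in\Gamma}\bigl|\mu_n(x)-\mathrm{vol}(\mathbb R^m/\Gamma)\,\xi_{n\Sigma}(x)\bigr|\le\frac{C}{n^{(m+1)/2}}\qquad\text{for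 all integers }n\ge1 .$$ (If the scale in $\mathbb R^m$ is normalized by a homothety so that $\mathrm{vol}(\mathbb R^m/\Gamma)=1$, the main term is $\xi_{n\Sigma}(x)$.) Moreover, $\Sigma$ is given by $$\langle v_1,\Sigma v_2\rangle=\sum_{e\in E(G)}u_1(e)\,u_2(e)\,c(e)\qquad(v_1,v_2\in\mathbb R^m),$$ where $u_i$ is the harmonic part of $\hat v_i$ for $i=1,2$. -/

import Mathlib

open scoped InnerProductSpace

noncomputable section

universe u

namespace LatticeWalk

/-! ## Finite networks, 1-forms and their harmonic parts -/

/-- A finite multigraph, loops allowed, given by its oriented edges: every edge `e` has an origin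
`org e`, a terminus `org (rev e)` and a reversed edge `rev e`; it carries a positive conductance
which does not depend on the orientation. -/
structure Network where
  V : Type u
  E : Type u
  [fintypeV : Fintype V]
  [fintypeE : Fintype E]
  org : E → V
  rev : E → E
  rev_rev : ∀ e, rev (rev e) = e
  c : E → ℝ
  c_pos : ∀ e, 0 < c e
  c_rev : ∀ e, c (rev e) = c e

attribute [instance] Network.fintypeV Network.fintypeE

namespace Network

variable (N : Network)

/-- The terminus of an oriented edge. -/
def ter (e : N.E) : N.V := N.org (N.rev e)

open Classical in
/-- The oriented edges which start at the vertex `x`. -/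
def edgesFrom (x : N.V) : Finset N.E := Finset.univ.filter fun e => N.org e = x

/-- The weight of a vertex: the total conductance of the edges which start there. -/
def vertexWeight (x : N.V) : ℝ := ∑ e ∈ N.edgesFrom x, N.c e

/-- The real 1-forms: the functions on the oriented edges with `ω (rev e) = - ω e`. -/
def OneForm : Submodule ℝ (N.E → ℝ) where
  carrier := {ω | ∀ e, ω (N.rev e) = - ω e}
  add_mem' := by
    intro a b ha hb e
    simp only [Pi.add_apply, ha e, hb e]
    ring
  zero_mem' := by
    intro e
    simp
  smul_mem' := by
    intro r a ha e
    simp [ha e]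

/-- The differential `df e = f (ter e) - f (org e)`. -/
def d : (N.V → ℝ) →ₗ[ℝ] N.OneForm where
  toFun f := ⟨fun e => f (N.ter e) - f (N.org e), by
    intro e
    simp [ter, N.rev_rev]⟩
  map_add' f g := by
    ext e
    simp only [Pi.add_apply, Submodule.coe_add]
    ring
  map_smul' r f := by
    ext e
    simp only [Pi.smul_apply, smul_eq_mul, RingHom.id_apply, Submodule.coe_smul]
    ring

/-- The codifferential `d* ω x = - ∑ c e / π x * ω e`, the sum being over the edges `e` which
start at `x`, where `π x` is the weight of `x`. -/
def dStar (ω : N.OneForm) (x : N.V) : ℝ :=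
  - ∑ e ∈ N.edgesFrom x, 1 / N.vertexWeight x * N.c e * ω.1 e

/-- `u` is the harmonic part of the 1-form `ω`: `u` is harmonic (`d* u = 0`), and `ω` is the sum
of `u` and of the differential of a function on the vertices. -/
def IsHarmonicPart (ω u : N.OneForm) : Prop :=
  (∀ x, N.dStar u x = 0) ∧ ∃ f : N.V → ℝ, u + N.d f = ω

/-- The inner product `∑ ω₁ e * ω₂ e * c e / 2` on 1-forms. -/
def form : LinearMap.BilinForm ℝ N.OneForm :=
  LinearMap.mk₂ ℝ (fun ω₁ ω₂ => 1 / 2 * ∑ e, ω₁.1 e * ω₂.1 e * N.c e)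
    (by intro a b w; simp [add_mul, Finset.sum_add_distrib, mul_add])
    (by intro r a w; simp [Finset.mul_sum, mul_assoc, mul_left_comm])
    (by intro a b w; simp [add_mul, mul_add, Finset.sum_add_distrib])
    (by intro r a w; simp [Finset.mul_sum, mul_assoc, mul_left_comm])

theorem form_apply (a b : N.OneForm) :
    N.form a b = 1 / 2 * ∑ e, a.1 e * b.1 e * N.c e := rfl

theorem form_self_eq_zero {a : N.OneForm} (h : N.form a a = 0) : a = 0 := by
  rw [form_apply] at h
  have h' : ∑ e, a.1 e * a.1 e * N.c e = 0 := by linarith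
  rw [Finset.sum_eq_zero_iff_of_nonneg
    (fun e _ => mul_nonneg (mul_self_nonneg _) (N.c_pos e).le)] at h'
  ext e
  have := h' e (Finset.mem_univ e)
  have hc := (N.c_pos e).ne'
  simpa [hc] using this

theorem sum_rev (g : N.E → ℝ) : ∑ e, g (N.rev e) = ∑ e, g e :=
  Equiv.sum_comp (Function.Involutive.toPerm N.rev N.rev_rev) g

theorem form_d (f : N.V → ℝ) (w : N.OneForm) :
    N.form (N.d f) w = - ∑ e, f (N.org e) * (N.c e * w.1 e) := by
  have h1 : ∑ e, f (N.ter e) * (N.c e * w.1 e) = - ∑ e, f (N.org e) * (N.c e * w.1 e) := by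
    rw [← N.sum_rev, ← Finset.sum_neg_distrib]
    refine Finset.sum_congr rfl fun e _ => ?_
    rw [ter, N.rev_rev, N.c_rev, w.2 e]
    ring
  have h2 : ∑ e, (N.d f).1 e * w.1 e * N.c e
      = ∑ e, f (N.ter e) * (N.c e * w.1 e) - ∑ e, f (N.org e) * (N.c e * w.1 e) := by
    rw [← Finset.sum_sub_distrib]
    refine Finset.sum_congr rfl fun e _ => ?_
    change (f (N.ter e) - f (N.org e)) * w.1 e * N.c e = _
    ring
  rw [form_apply, h2, h1]
  ring

open Classical in
/-- A 1-form is harmonic if and only if it is orthogonal to all differentials. -/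
theorem dStar_eq_zero_iff (w : N.OneForm) :
    (∀ x, N.dStar w x = 0) ↔ ∀ f, N.form (N.d f) w = 0 := by
  have key : ∀ x, N.dStar w x = 0 ↔ ∑ e ∈ N.edgesFrom x, N.c e * w.1 e = 0 := by
    intro x
    have e1 : N.dStar w x
        = - (1 / N.vertexWeight x * ∑ e ∈ N.edgesFrom x, N.c e * w.1 e) := by
      simp only [dStar, Finset.mul_sum, mul_assoc]
    rw [e1, neg_eq_zero, mul_eq_zero]
    refine ⟨fun h => h.elim (fun h => ?_) id, Or.inr⟩
    have hz : N.vertexWeight x = 0 := by simpa using h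
    rw [vertexWeight, Finset.sum_eq_zero_iff_of_nonneg (fun e _ => (N.c_pos e).le)] at hz
    exact Finset.sum_eq_zero fun e he => absurd (hz e he) (N.c_pos e).ne'
  have hsum : ∀ f : N.V → ℝ, ∑ e, f (N.org e) * (N.c e * w.1 e)
      = ∑ x, f x * ∑ e ∈ N.edgesFrom x, N.c e * w.1 e := by
    intro f
    rw [← Finset.sum_fiberwise_of_maps_to (s := Finset.univ) (t := Finset.univ) (g := N.org)
      (fun _ _ => Finset.mem_univ _)]
    refine Finset.sum_congr rfl fun x _ => ?_
    rw [Finset.mul_sum]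
    refine Finset.sum_congr (by unfold edgesFrom; congr) fun e he => ?_
    rw [(Finset.mem_filter.1 he).2]
  simp only [key, form_d, hsum, neg_eq_zero]
  constructor
  · intro h f
    simp [h]
  · intro h x
    have := h (Pi.single x 1)
    simpa [Pi.single_apply] using this

/-- Every 1-form has one and only one harmonic part. -/
theorem existsUnique_isHarmonicPart (ω : N.OneForm) : ∃! u, N.IsHarmonicPart ω u := by
  have hsymm : ∀ a b, N.form a b = N.form b a := fun a b => by
    simp only [form_apply, mul_comm]
  have hrefl : N.form.IsRefl := fun a b h => by rw [hsymm, h]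
  have hnd : (N.form.restrict (LinearMap.range N.d)).Nondegenerate := by
    constructor
    · intro a ha
      exact Subtype.ext (N.form_self_eq_zero (ha a))
    · intro a ha
      exact Subtype.ext (N.form_self_eq_zero (ha a))
  have hcompl := LinearMap.BilinForm.isCompl_orthogonal_of_restrict_nondegenerate hrefl hnd
  have hmem : ω ∈ LinearMap.range N.d ⊔ N.form.orthogonal (LinearMap.range N.d) := by
    rw [hcompl.sup_eq_top]
    trivial
  obtain ⟨_, ⟨f, rfl⟩, u, hu, hfu⟩ := Submodule.mem_sup.1 hmem
  refine ⟨u, ⟨(N.dStar_eq_zero_iff u).2 fun g => hu _ ⟨g, rfl⟩, f, by rw [add_comm, hfu]⟩, ?_⟩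
  rintro u' ⟨hu', f', hf'⟩
  rw [dStar_eq_zero_iff] at hu'
  have hdiff : u' - u = N.d (f - f') := by
    rw [map_sub, sub_eq_sub_iff_add_eq_add, hf', ← hfu]
  have hz : N.form (u' - u) (u' - u) = 0 := by
    nth_rewrite 1 [hdiff]
    rw [map_sub, hu', hu _ ⟨_, rfl⟩, sub_zero]
  exact sub_eq_zero.1 (N.form_self_eq_zero hz)

/-- The harmonic part of a 1-form. -/
def harmonicPart (ω : N.OneForm) : N.OneForm := (N.existsUnique_isHarmonicPart ω).choose

theorem harmonicPart_spec (ω : N.OneForm) : N.IsHarmonicPart ω (N.harmonicPart ω) :=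
  (N.existsUnique_isHarmonicPart ω).choose_spec.1

end Network

/-! ## Random walks -/

section Walk

variable {Γ : Type*} [Group Γ]

/-- The `n`-fold convolution power of `μ`, the law of `s₁ * s₂ * ⋯ * sₙ` for independent factors
`s₁, …, sₙ` with law `μ`. -/
def convPow (μ : PMF Γ) : ℕ → PMF Γ
  | 0 => PMF.pure 1
  | n + 1 => (convPow μ n).bind fun x => μ.map fun s => x * s

/-- Right multiplication on the set `Λ \ Γ` of the cosets `Λ x`. -/
def cosetMul (Λ : Subgroup Γ) (x : Quotient (QuotientGroup.rightRel Λ)) (s : Γ) :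
    Quotient (QuotientGroup.rightRel Λ) :=
  Quotient.map (fun g => g * s) (by
    intro a b h
    rw [← Quotient.eq_iff_equiv, Quotient.eq, QuotientGroup.rightRel_apply] at h ⊢
    simpa [mul_assoc] using h) x

theorem cosetMul_mk (Λ : Subgroup Γ) (g s : Γ) :
    cosetMul Λ (Quotient.mk _ g) s = Quotient.mk _ (g * s) := rfl

theorem cosetMul_cosetMul_inv (Λ : Subgroup Γ) (x : Quotient (QuotientGroup.rightRel Λ)) (s : Γ) :
    cosetMul Λ (cosetMul Λ x s) s⁻¹ = x := by
  induction x using Quotient.inductionOn with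
  | h g => simp [cosetMul_mk]

/-- The quotient by `Λ` of the Cayley graph of `Γ` with respect to the support of `μ`. Its vertices
are the cosets `Λ x`. Its oriented edges are the pairs of a vertex `x` and an element `s` of the
support of `μ`; such an edge goes from `x` to `x s`, its reverse is `(x s, s⁻¹)`, and its
conductance is `μ s` divided by the number of vertices. -/
def quotientNetwork (Λ : Subgroup Γ) [Λ.FiniteIndex] (μ : PMF Γ) (hfin : μ.support.Finite)
    (hsymm : ∀ s, μ s⁻¹ = μ s) : Network where
  V := Quotient (QuotientGroup.rightRel Λ)
  E := Quotient (QuotientGroup.rightRel Λ) × μ.support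
  fintypeV :=
    letI := Λ.fintypeQuotientOfFiniteIndex
    Fintype.ofEquiv _ (QuotientGroup.quotientRightRelEquivQuotientLeftRel Λ).symm
  fintypeE :=
    letI := Λ.fintypeQuotientOfFiniteIndex
    letI := hfin.fintype
    letI := Fintype.ofEquiv _ (QuotientGroup.quotientRightRelEquivQuotientLeftRel Λ).symm
    inferInstance
  org e := e.1
  rev e := (cosetMul Λ e.1 e.2, ⟨(e.2 : Γ)⁻¹, by
    rw [PMF.mem_support_iff, hsymm]
    exact e.2.2⟩)
  rev_rev := by
    rintro ⟨x, s⟩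
    simp [cosetMul_cosetMul_inv]
  c e := (μ e.2).toReal / Λ.index
  c_pos := by
    rintro ⟨x, s, hs⟩
    refine div_pos (ENNReal.toReal_pos hs (μ.apply_ne_top s)) ?_
    exact_mod_cast Nat.pos_of_ne_zero Subgroup.FiniteIndex.index_ne_zero
  c_rev := by
    rintro ⟨x, s⟩
    simp [hsymm]

end Walk

/-! ## Isometric actions on a Euclidean space -/

section Action

variable {Γ : Type*} [Group Γ] {m : ℕ}

/-- `F` is a fundamental domain for the isometric action `ρ`: the translates of the closure of `F`
cover the space, and the translates of the interior of `F` are pairwise disjoint. (So `F` may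
contain its boundary, or a part of it, or nothing of it.) -/
structure IsFundamentalDomain
    (ρ : Γ →* (EuclideanSpace ℝ (Fin m) ≃ᵢ EuclideanSpace ℝ (Fin m)))
    (F : Set (EuclideanSpace ℝ (Fin m))) : Prop where
  covers : ⋃ g, ρ g '' closure F = Set.univ
  disjoint : ∀ g h, g ≠ h → Disjoint (ρ g '' interior F) (ρ h '' interior F)

/-- The subgroup `Λ` acts by translations. -/
def ActsByTranslations
    (ρ : Γ →* (EuclideanSpace ℝ (Fin m) ≃ᵢ EuclideanSpace ℝ (Fin m))) (Λ : Subgroup Γ) : Prop :=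
  ∀ g ∈ Λ, ∃ t, ∀ y, ρ g y = y + t

/-- The orbit map of the origin. -/
def orbitMap (ρ : Γ →* (EuclideanSpace ℝ (Fin m) ≃ᵢ EuclideanSpace ℝ (Fin m))) (x : Γ) :
    EuclideanSpace ℝ (Fin m) := ρ x 0

/-- The additive group generated by the orbit of the origin under `Λ`. If `Λ` acts by translations,
then it is this orbit, i.e. the group of the translation vectors of the elements of `Λ`. -/
def translationLattice (ρ : Γ →* (EuclideanSpace ℝ (Fin m) ≃ᵢ EuclideanSpace ℝ (Fin m)))
    (Λ : Subgroup Γ) : Submodule ℤ (EuclideanSpace ℝ (Fin m)) :=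
  Submodule.span ℤ (orbitMap ρ '' Λ)

variable {ρ : Γ →* (EuclideanSpace ℝ (Fin m) ≃ᵢ EuclideanSpace ℝ (Fin m))} {Λ : Subgroup Γ}

/-- The displacement `Φ (g s) - Φ g` of the orbit map `Φ` along an edge from `g` to `g s`, as a
function of the coset `Λ g` and of `s`. -/
def displacement (hΛ : ActsByTranslations ρ Λ) (x : Quotient (QuotientGroup.rightRel Λ)) (s : Γ) :
    EuclideanSpace ℝ (Fin m) :=
  Quotient.lift (fun g => orbitMap ρ (g * s) - orbitMap ρ g) (by
    intro a b h
    rw [← Quotient.eq_iff_equiv, Quotient.eq, QuotientGroup.rightRel_apply] at h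
    obtain ⟨t, ht⟩ := hΛ _ h
    have hb : ∀ r, orbitMap ρ (b * r) = orbitMap ρ (a * r) + t := by
      intro r
      have e : b * r = (b * a⁻¹) * (a * r) := by group
      rw [e, orbitMap, map_mul, IsometryEquiv.mul_apply, ht]
      rfl
    have hb1 := hb 1
    rw [mul_one, mul_one] at hb1
    change orbitMap ρ (a * s) - orbitMap ρ a = orbitMap ρ (b * s) - orbitMap ρ b
    rw [hb, hb1]
    abel) x

theorem displacement_mk (hΛ : ActsByTranslations ρ Λ) (g s : Γ) :
    displacement hΛ (Quotient.mk _ g) s = orbitMap ρ (g * s) - orbitMap ρ g := rfl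

/-- The 1-form on the quotient network whose value on an edge is the inner product of `v` with the
displacement along this edge. -/
def linearForm (hΛ : ActsByTranslations ρ Λ) [Λ.FiniteIndex] (μ : PMF Γ)
    (hfin : μ.support.Finite) (hsymm : ∀ s, μ s⁻¹ = μ s) (v : EuclideanSpace ℝ (Fin m)) :
    (quotientNetwork Λ μ hfin hsymm).OneForm :=
  ⟨fun e => ⟪v, displacement hΛ e.1 e.2⟫_ℝ, by
    rintro ⟨x, s⟩
    induction x using Quotient.inductionOn with
    | h g =>
      change ⟪v, displacement hΛ (cosetMul Λ (Quotient.mk _ g) s) (s : Γ)⁻¹⟫_ℝ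
        = - ⟪v, displacement hΛ (Quotient.mk _ g) s⟫_ℝ
      rw [cosetMul_mk, displacement_mk, displacement_mk, ← inner_neg_right, neg_sub,
        mul_inv_cancel_right]⟩

/-- The density at `y` of the centred normal distribution with covariance matrix `A`. -/
def gaussianDensity (A : Matrix (Fin m) (Fin m) ℝ) (y : EuclideanSpace ℝ (Fin m)) : ℝ :=
  1 / ((2 * Real.pi) ^ ((m : ℝ) / 2) * √A.det) *
    Real.exp (-(1 / 2) * ⟪y, Matrix.toEuclideanLin A⁻¹ y⟫_ℝ)

end Action

end LatticeWalk

end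

/-! The proof is Fourier analysis over the finite quotient. Write V = [Γ:Λ]. For θ in ℝ^m, the walk
acts on the functions e^{i⟨θ,Φ⟩}·(Λ-invariant function) through the transition operator T_θ of the
quotient network twisted by the phases e^{iθ̂} (`average_exp_mul`). Orthogonality of characters on
the dual cube of a basis of Λ gives `convPow_toReal_eq_integral`: μ_n(x) = covol(Λ)/(2π)^m · ∫
e^{-i⟨θ,Φ(x)⟩} (T_θ^n δ_{Λx})(Λ) dθ.

The heart is `IsUniform.norm_transfer_pow_single_sub_le`: on the dual cube, the entries of T_θ^n are
V⁻¹ e^{-nq(θ)} up to O(n^{-1/2} e^{-cn‖θ‖²}), where q(θ) = ½ ∑ u²c = ½⟨θ,Σθ⟩ and u is the harmonic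
part of θ̂ = u + dφ. No perturbation theory of eigenvalues is needed. Conjugation by e^{-iφ}
replaces θ̂ by u, whose mean at every vertex is zero. The second order term ½E_x[u²] depends on the
vertex x, and a second corrector γ, obtained from a Poisson equation, averages it to q. So η =
e^{-iφ}(1+γ) satisfies T_θ η = e^{-q} η + O(‖θ‖³), and telescoping costs n‖θ‖³. To pass from η to
δ_z, one uses η = 1 + O(‖θ‖) and δ_z - V⁻¹ = (1-T_0)g_z: after T_θ^n, the factor 1-T_θ costs 1/n,
and T_θ-T_0 costs ‖θ‖. Against a Gaussian, each of ‖θ‖, n‖θ‖³ and 1/n is O(n^{-1/2}).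

The decay of T_θ^n comes from a spectral gap. Loops at the identity keep the spectrum away from -1.
Near 1, ⟨f,(1-T_θ)f⟩ is a Dirichlet energy, and small energy makes f almost parallel along closed
paths whose holonomies are e^{i⟨θ,b_j⟩} for a lattice basis b_j; these are far from 1 unless θ is
small (`exists_mul_le_energy`).

Integration over θ contributes the remaining n^{-m/2}. Finally Σ is positive definite: if the
harmonic part of v̂ vanishes, then v̂ is exact, so ⟨v,Φ⟩ vanishes on Λ, whose orbit is cobounded;
hence v = 0. -/

noncomputable section

namespace LatticeWalk

/-! ## Powers of symmetric operators -/

section Symmetric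

variable {H : Type*} [NormedAddCommGroup H] [InnerProductSpace ℂ H] [FiniteDimensional ℂ H]

/-- A polynomial in a symmetric operator is bounded by its supremum on the eigenvalues. -/
theorem norm_aeval_le_of_isSymmetric {T : H →ₗ[ℂ] H} (hT : T.IsSymmetric) (p : Polynomial ℂ)
    {B : ℝ} (hB : 0 ≤ B)
    (h : ∀ (t : ℝ) (v : H), v ≠ 0 → T v = (t : ℂ) • v → ‖p.eval (t : ℂ)‖ ≤ B) (v : H) :
    ‖Polynomial.aeval T p v‖ ≤ B * ‖v‖ := by
  set b := hT.eigenvectorBasis rfl with hb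
  have hpow : ∀ i, Polynomial.aeval T p (b i) = p.eval ((hT.eigenvalues rfl i : ℝ) : ℂ) • b i := by
    intro i
    refine Module.End.aeval_apply_of_hasEigenvector
      ((Module.End.hasEigenvector_iff).2 ⟨?_, ?_⟩)
    · exact Module.End.mem_eigenspace_iff.2 (hT.apply_eigenvectorBasis rfl i)
    · exact b.orthonormal.ne_zero i
  have hrepr : Polynomial.aeval T p v
      = ∑ i, (b.repr v i * p.eval ((hT.eigenvalues rfl i : ℝ) : ℂ)) • b i := by
    conv_lhs => rw [← b.sum_repr v, map_sum]
    simp only [map_smul, hpow, smul_smul]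
  have hsq : ‖Polynomial.aeval T p v‖ ^ 2 ≤ (B * ‖v‖) ^ 2 := by
    have e1 : ‖Polynomial.aeval T p v‖ ^ 2
        = ∑ i, ‖b.repr v i * p.eval ((hT.eigenvalues rfl i : ℝ) : ℂ)‖ ^ 2 := by
      rw [← b.sum_sq_norm_inner_right]
      refine Finset.sum_congr rfl fun i _ => ?_
      rw [hrepr, b.orthonormal.inner_right_fintype]
    have e2 : ‖v‖ ^ 2 = ∑ i, ‖b.repr v i‖ ^ 2 := by
      rw [← b.sum_sq_norm_inner_right]
      simp only [b.repr_apply_apply]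
    rw [e1, mul_pow, e2, Finset.mul_sum]
    refine Finset.sum_le_sum fun i _ => ?_
    rw [norm_mul, mul_pow, mul_comm]
    gcongr
    exact h _ _ (b.orthonormal.ne_zero i) (hT.apply_eigenvectorBasis rfl i)
  exact le_of_sq_le_sq hsq (by positivity)

theorem abs_pow_le_exp {t s : ℝ} (h1 : -Real.exp (-s) ≤ t) (h2 : t ≤ Real.exp (-s)) (n : ℕ) :
    |t| ^ n ≤ Real.exp (-(n * s)) := by
  have : |t| ≤ Real.exp (-s) := abs_le.2 ⟨h1, h2⟩
  calc |t| ^ n ≤ Real.exp (-s) ^ n := by gcongr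
    _ = _ := by rw [← Real.exp_nat_mul]; ring_nf

/-- If `-1 + δ ≤ t ≤ 1 - a`, where `a` is bounded, then `|t| ^ n` and `|t| ^ n * (1 - t)`
decay exponentially in `n a`, the latter with an additional factor of `1 / n`. -/
theorem pow_bounds {δ R : ℝ} (hδ : 0 < δ) (hR : 0 < R) : ∃ c C : ℝ, 0 < c ∧ 0 < C ∧
    ∀ a t : ℝ, 0 ≤ a → a ≤ R → -1 + δ ≤ t → t ≤ 1 - a → ∀ n : ℕ, 0 < n →
      |t| ^ n ≤ Real.exp (-(c * n * a)) ∧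
      |t| ^ n * |1 - t| ≤ C / n * Real.exp (-(c * n * a)) := by
  have key : ∀ x : ℝ, 0 ≤ x → x * Real.exp (-x) ≤ 1 := by
    intro x _
    have := Real.add_one_le_exp x
    rw [Real.exp_neg, ← div_eq_mul_inv, div_le_one (Real.exp_pos x)]
    linarith
  -- Half of the decay rate yields the exponential in `a`, the other half absorbs the factor `1 -
  -- t`. For `t ≥ 0` the rate is `1 - t ≥ a`, which allows `c ≤ 1/2` and costs `2 / n`. For `t ≤ 0`
  -- the rate is `δ`, and `a ≤ R` allows `c ≤ δ / (2R)` at the cost of `(4/δ) / n`.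
  refine ⟨min (1 / 2) (δ / (2 * R)), 2 + 4 / δ, by positivity, by positivity, ?_⟩
  intro a t ha haR ht1 ht2 n hn
  have hn' : (0 : ℝ) < n := by exact_mod_cast hn
  set c := min (1 / 2) (δ / (2 * R)) with hc
  have hc1 : c * a ≤ a / 2 := by
    have : c ≤ 1 / 2 := min_le_left _ _
    nlinarith
  have hc2 : c * a ≤ δ / 2 := by
    calc c * a ≤ δ / (2 * R) * R := by gcongr; exact min_le_right _ _
      _ = δ / 2 := by field_simp
  rcases le_total 0 t with h0 | h0
  · have hb : 0 ≤ 1 - t := by linarith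
    have ht : |t| ^ n ≤ Real.exp (-(n * (1 - t))) := by
      refine abs_pow_le_exp ?_ ?_ n
      · linarith [Real.exp_pos (-(1 - t))]
      · linarith [Real.add_one_le_exp (-(1 - t))]
    have hexp : Real.exp (-(n * (1 - t))) ≤ Real.exp (-(c * n * a)) * Real.exp (-(n * (1 - t) / 2)) := by
      rw [← Real.exp_add, Real.exp_le_exp]
      nlinarith
    constructor
    · refine ht.trans (hexp.trans ?_)
      refine mul_le_of_le_one_right (Real.exp_pos _).le ?_
      rw [Real.exp_le_one_iff]
      have : 0 ≤ n * (1 - t) := by positivity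
      linarith
    · rw [abs_of_nonneg hb]
      have k := key (n * (1 - t) / 2) (by positivity)
      calc |t| ^ n * (1 - t)
          ≤ (Real.exp (-(c * n * a)) * Real.exp (-(n * (1 - t) / 2))) * (1 - t) := by
            gcongr; exact ht.trans hexp
        _ = (n * (1 - t) / 2 * Real.exp (-(n * (1 - t) / 2))) * (2 / n)
            * Real.exp (-(c * n * a)) := by field_simp
        _ ≤ 1 * (2 / n) * Real.exp (-(c * n * a)) := by gcongr
        _ ≤ (2 + 4 / δ) / n * Real.exp (-(c * n * a)) := by
            rw [one_mul]; gcongr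
            linarith [show 0 < 4 / δ by positivity]
  · have hδ1 : δ ≤ 1 := by linarith
    have ht : |t| ^ n ≤ Real.exp (-(n * δ)) := by
      refine abs_pow_le_exp ?_ ?_ n
      · linarith [Real.add_one_le_exp (-δ)]
      · linarith [Real.exp_pos (-δ)]
    have hexp : Real.exp (-(n * δ)) ≤ Real.exp (-(c * n * a)) * Real.exp (-(n * δ / 2)) := by
      rw [← Real.exp_add, Real.exp_le_exp]
      nlinarith
    constructor
    · refine ht.trans (hexp.trans ?_)
      refine mul_le_of_le_one_right (Real.exp_pos _).le ?_
      rw [Real.exp_le_one_iff]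
      have : 0 ≤ n * δ := by positivity
      linarith
    · have hb : |1 - t| ≤ 2 := by rw [abs_le]; constructor <;> linarith
      have k := key (n * δ / 2) (by positivity)
      calc |t| ^ n * |1 - t|
          ≤ (Real.exp (-(c * n * a)) * Real.exp (-(n * δ / 2))) * 2 := by
            gcongr; exact ht.trans hexp
        _ = (n * δ / 2 * Real.exp (-(n * δ / 2))) * (4 / δ / n)
            * Real.exp (-(c * n * a)) := by field_simp; ring
        _ ≤ 1 * (4 / δ / n) * Real.exp (-(c * n * a)) := by gcongr
        _ ≤ (2 + 4 / δ) / n * Real.exp (-(c * n * a)) := by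
            rw [one_mul]; gcongr
            linarith

end Symmetric

/-! ## Twisted transition operators of a finite network -/

namespace Network

variable (N : Network)

/-- The transition probability along an edge, if all vertices have the same weight and the total
conductance is `1`. -/
def prob (e : N.E) : ℝ := N.c e * Fintype.card N.V

/-- All vertices have the same weight, and the total conductance is `1`. -/
def IsUniform : Prop := ∀ x, N.vertexWeight x = (Fintype.card N.V : ℝ)⁻¹

theorem prob_nonneg (e : N.E) : 0 ≤ N.prob e := mul_nonneg (N.c_pos e).le (Nat.cast_nonneg _)

theorem prob_rev (e : N.E) : N.prob (N.rev e) = N.prob e := by rw [prob, N.c_rev, prob]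

theorem ter_rev (e : N.E) : N.ter (N.rev e) = N.org e := by rw [ter, N.rev_rev]

theorem mem_edgesFrom {x : N.V} {e : N.E} : e ∈ N.edgesFrom x ↔ N.org e = x := by
  simp [edgesFrom]

theorem sum_edgesFrom {R : Type*} [AddCommMonoid R] (g : N.E → R) :
    ∑ x, ∑ e ∈ N.edgesFrom x, g e = ∑ e, g e := by
  classical
  rw [← Finset.sum_fiberwise_of_maps_to (s := Finset.univ) (t := Finset.univ) (g := N.org)
      (fun _ _ => Finset.mem_univ _)]
  exact Finset.sum_congr rfl fun x _ => Finset.sum_congr (by unfold edgesFrom; congr) fun _ _ => rfl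

variable {N} in
theorem IsUniform.sum_prob (h : N.IsUniform) (x : N.V) : ∑ e ∈ N.edgesFrom x, N.prob e = 1 := by
  have : Nonempty N.V := ⟨x⟩
  have := h x
  rw [vertexWeight] at this
  simp only [prob, ← Finset.sum_mul, this]
  field_simp

/-- The transition operator twisted by a 1-form. -/
def transfer (w : N.OneForm) : EuclideanSpace ℂ N.V →ₗ[ℂ] EuclideanSpace ℂ N.V where
  toFun f := WithLp.toLp 2 fun x =>
    ∑ e ∈ N.edgesFrom x, (N.prob e : ℂ) * (Complex.exp (w.1 e * Complex.I) * f (N.ter e))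
  map_add' f g := by
    ext x
    simp [mul_add, Finset.sum_add_distrib]
  map_smul' r f := by
    ext x
    simp only [PiLp.smul_apply, smul_eq_mul, RingHom.id_apply, Finset.mul_sum]
    refine Finset.sum_congr rfl fun e _ => ?_
    ring

theorem transfer_apply (w : N.OneForm) (f : EuclideanSpace ℂ N.V) (x : N.V) :
    N.transfer w f x = ∑ e ∈ N.edgesFrom x,
      (N.prob e : ℂ) * (Complex.exp (w.1 e * Complex.I) * f (N.ter e)) := rfl

theorem inner_transfer (w : N.OneForm) (f g : EuclideanSpace ℂ N.V) :
    ⟪f, N.transfer w g⟫_ℂ = ∑ e, (N.prob e : ℂ) *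
      (starRingEnd ℂ (f (N.org e)) * (Complex.exp (w.1 e * Complex.I) * g (N.ter e))) := by
  rw [PiLp.inner_apply, ← N.sum_edgesFrom]
  refine Finset.sum_congr rfl fun x _ => ?_
  rw [transfer_apply, RCLike.inner_apply, Finset.sum_mul]
  refine Finset.sum_congr rfl fun e he => ?_
  rw [N.mem_edgesFrom.1 he]
  ring

/-- Reversal of edges preserves the probabilities and conjugates the phases, since a 1-form changes
sign. -/
theorem transfer_isSymmetric (w : N.OneForm) : (N.transfer w).IsSymmetric := by
  intro f g
  rw [← inner_conj_symm, inner_transfer, inner_transfer, map_sum]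
  have hinv : Function.Involutive N.rev := N.rev_rev
  rw [← hinv.bijective.sum_comp fun e => (N.prob e : ℂ) *
      (starRingEnd ℂ (f (N.org e)) * (Complex.exp (w.1 e * Complex.I) * g (N.ter e)))]
  refine Finset.sum_congr rfl fun e _ => ?_
  rw [ter_rev, prob_rev, w.2 e, ← ter]
  simp only [map_mul, Complex.conj_ofReal, ← Complex.exp_conj, Complex.conj_I, Complex.conj_conj,
    Complex.ofReal_neg]
  ring_nf

/-- The Dirichlet energy of a function with respect to the connection given by a 1-form. -/
def energy (w : N.OneForm) (f : EuclideanSpace ℂ N.V) : ℝ :=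
  1 / 2 * ∑ e, N.prob e * ‖f (N.org e) - Complex.exp (w.1 e * Complex.I) * f (N.ter e)‖ ^ 2

theorem energy_nonneg (w : N.OneForm) (f : EuclideanSpace ℂ N.V) : 0 ≤ N.energy w f :=
  mul_nonneg (by norm_num)
    (Finset.sum_nonneg fun e _ => mul_nonneg (N.prob_nonneg e) (by positivity))

variable {N}

theorem IsUniform.sum_prob_mul_org (h : N.IsUniform) (g : N.V → ℝ) :
    ∑ e, N.prob e * g (N.org e) = ∑ x, g x := by
  rw [← N.sum_edgesFrom]
  refine Finset.sum_congr rfl fun x _ => ?_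
  rw [← one_mul (g x), ← h.sum_prob x, Finset.sum_mul]
  refine Finset.sum_congr rfl fun e he => ?_
  rw [N.mem_edgesFrom.1 he]

theorem IsUniform.sum_prob_mul_ter (h : N.IsUniform) (g : N.V → ℝ) :
    ∑ e, N.prob e * g (N.ter e) = ∑ x, g x := by
  rw [← h.sum_prob_mul_org, ← N.sum_rev]
  simp only [ter_rev, prob_rev]

/-- Expand the square: the phases are unimodular and the vertex weights are equal, so each diagonal
part sums to `‖f‖ ^ 2`. The case `s = 1` controls the spectrum near 1, the case `s = -1` near -1. -/
theorem IsUniform.sum_norm_sub_mul (h : N.IsUniform) (w : N.OneForm) (f : EuclideanSpace ℂ N.V)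
    {s : ℝ} (hs : s ^ 2 = 1) :
    1 / 2 * ∑ e, N.prob e *
      ‖f (N.org e) - s * (Complex.exp (w.1 e * Complex.I) * f (N.ter e))‖ ^ 2
    = ‖f‖ ^ 2 - s * (⟪f, N.transfer w f⟫_ℂ).re := by
  have e1 : ∀ e, N.prob e *
      ‖f (N.org e) - s * (Complex.exp (w.1 e * Complex.I) * f (N.ter e))‖ ^ 2
      = N.prob e * ‖f (N.org e)‖ ^ 2 + N.prob e * ‖f (N.ter e)‖ ^ 2
        - 2 * s * ((N.prob e : ℂ) * (starRingEnd ℂ (f (N.org e)) *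
          (Complex.exp (w.1 e * Complex.I) * f (N.ter e)))).re := by
    intro e
    have hn : ‖(s : ℂ) * (Complex.exp (w.1 e * Complex.I) * f (N.ter e))‖ ^ 2
        = ‖f (N.ter e)‖ ^ 2 := by
      rw [norm_mul, norm_mul, Complex.norm_exp_ofReal_mul_I, Complex.norm_real, one_mul, mul_pow,
        Real.norm_eq_abs, sq_abs, hs, one_mul]
    have hi := norm_sub_sq (𝕜 := ℂ) (f (N.org e))
      ((s : ℂ) * (Complex.exp (w.1 e * Complex.I) * f (N.ter e)))
    rw [hn, RCLike.inner_apply] at hi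
    rw [hi, Complex.re_ofReal_mul]
    have : RCLike.re ((s : ℂ) * (Complex.exp (w.1 e * Complex.I) * f (N.ter e)) *
        starRingEnd ℂ (f (N.org e)))
        = s * (starRingEnd ℂ (f (N.org e)) *
          (Complex.exp (w.1 e * Complex.I) * f (N.ter e))).re := by
      rw [← Complex.re_ofReal_mul]
      change Complex.re _ = _
      ring_nf
    rw [this]
    ring
  rw [Finset.sum_congr rfl fun e _ => e1 e, Finset.sum_sub_distrib, Finset.sum_add_distrib,
    h.sum_prob_mul_org (fun x => ‖f x‖ ^ 2), h.sum_prob_mul_ter (fun x => ‖f x‖ ^ 2),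
    ← Finset.mul_sum, ← Complex.re_sum, ← inner_transfer, EuclideanSpace.norm_sq_eq]
  ring

theorem IsUniform.energy_eq (h : N.IsUniform) (w : N.OneForm) (f : EuclideanSpace ℂ N.V) :
    N.energy w f = ‖f‖ ^ 2 - (⟪f, N.transfer w f⟫_ℂ).re := by
  have := h.sum_norm_sub_mul w f (s := 1) (by norm_num)
  simpa [energy] using this

/-- Every vertex carries a loop, which is its own reverse, of probability at least `δ`. -/
def IsLazy (N : Network) (δ : ℝ) : Prop :=
  ∀ x, ∃ e, N.org e = x ∧ N.rev e = e ∧ δ ≤ N.prob e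

/-- A 1-form vanishes on a loop which is its own reverse. So, in the sum with `s = -1`, the loop at
`x` contributes `‖2 f x‖ ^ 2`, and the other edges contribute nonnegative terms. -/
theorem IsLazy.le_norm_sq_add (hl : N.IsLazy δ) (h : N.IsUniform) (w : N.OneForm)
    (f : EuclideanSpace ℂ N.V) :
    2 * δ * ‖f‖ ^ 2 ≤ ‖f‖ ^ 2 + (⟪f, N.transfer w f⟫_ℂ).re := by
  classical
  have := h.sum_norm_sub_mul w f (s := -1) (by norm_num)
  rw [neg_one_mul, sub_neg_eq_add] at this
  rw [← this]
  choose l hl1 hl2 hl3 using hl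
  have hinj : Function.Injective l := fun x y hxy => by rw [← hl1 x, hxy, hl1]
  have hw : ∀ x, w.1 (l x) = 0 := by
    intro x
    have := w.2 (l x)
    rw [hl2] at this
    linarith
  have hter : ∀ x, N.ter (l x) = x := fun x => by rw [ter, hl2, hl1]
  calc 2 * δ * ‖f‖ ^ 2 = 1 / 2 * ∑ x, δ * (4 * ‖f x‖ ^ 2) := by
        rw [EuclideanSpace.norm_sq_eq, ← Finset.mul_sum, ← Finset.mul_sum]; ring
    _ ≤ 1 / 2 * ∑ x, N.prob (l x) * ‖f (N.org (l x)) - ((-1 : ℝ) : ℂ) *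
          (Complex.exp (w.1 (l x) * Complex.I) * f (N.ter (l x)))‖ ^ 2 := by
        gcongr with x
        · exact N.prob_nonneg _
        · exact hl3 x
        · rw [hw, hl1, hter]
          simp only [Complex.ofReal_neg, Complex.ofReal_one, Complex.ofReal_zero, zero_mul,
            Complex.exp_zero, one_mul, neg_mul, sub_neg_eq_add, ← two_mul, norm_mul]
          norm_num [mul_pow]
    _ ≤ _ := by
        gcongr
        rw [← Finset.sum_image (f := fun e => N.prob e * ‖f (N.org e) - ((-1 : ℝ) : ℂ) *
          (Complex.exp (w.1 e * Complex.I) * f (N.ter e))‖ ^ 2) hinj.injOn]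
        exact Finset.sum_le_sum_of_subset_of_nonneg (Finset.subset_univ _)
          fun e _ _ => mul_nonneg (N.prob_nonneg e) (by positivity)

/-- A spectral gap, in the form of a lower bound on the energy, yields the decay of the powers of
the transition operator. -/
theorem IsUniform.pow_transfer_bounds (h : N.IsUniform) (hδ : 0 < δ) (hl : N.IsLazy δ) {R : ℝ}
    (hR : 0 < R) : ∃ c C : ℝ, 0 < c ∧ 0 < C ∧ ∀ (w : N.OneForm) (a : ℝ), 0 ≤ a → a ≤ R →
      (∀ f, a * ‖f‖ ^ 2 ≤ N.energy w f) → ∀ n : ℕ, 0 < n → ∀ f,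
      ‖(N.transfer w ^ n) f‖ ≤ Real.exp (-(c * n * a)) * ‖f‖ ∧
      ‖(N.transfer w ^ n) (f - N.transfer w f)‖ ≤ C / n * Real.exp (-(c * n * a)) * ‖f‖ := by
  obtain ⟨c, C, hc, hC, hb⟩ := pow_bounds (δ := 2 * δ) (R := R) (by positivity) hR
  refine ⟨c, C, hc, hC, ?_⟩
  intro w a ha haR hgap n hn f
  -- Evaluation on an eigenvector confines the spectrum to `[-1 + 2δ, 1 - a]`. The two claims are
  -- then functional calculus for `X ^ n` and `X ^ n * (1 - X)`.
  have heig : ∀ (t : ℝ) (v : EuclideanSpace ℂ N.V), v ≠ 0 → N.transfer w v = (t : ℂ) • v →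
      -1 + 2 * δ ≤ t ∧ t ≤ 1 - a := by
    intro t v hv hvt
    have hpos : 0 < ‖v‖ ^ 2 := by positivity
    have hi : (⟪v, N.transfer w v⟫_ℂ).re = t * ‖v‖ ^ 2 := by
      rw [hvt, inner_smul_right, inner_self_eq_norm_sq_to_K, Complex.re_ofReal_mul]
      norm_cast
    have h1 := hl.le_norm_sq_add h w v
    have h2 := hgap v
    rw [h.energy_eq] at h2
    rw [hi] at h1 h2
    constructor <;> nlinarith
  constructor
  · have := norm_aeval_le_of_isSymmetric (N.transfer_isSymmetric w) (Polynomial.X ^ n)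
      (B := Real.exp (-(c * n * a))) (by positivity) (fun t v hv hvt => by
        obtain ⟨h1, h2⟩ := heig t v hv hvt
        simpa using (hb a t ha haR h1 h2 n hn).1) f
    simpa using this
  · have := norm_aeval_le_of_isSymmetric (N.transfer_isSymmetric w)
      (Polynomial.X ^ n * (1 - Polynomial.X))
      (B := C / n * Real.exp (-(c * n * a))) (by positivity) (fun t v hv hvt => by
        obtain ⟨h1, h2⟩ := heig t v hv hvt
        have := (hb a t ha haR h1 h2 n hn).2
        rw [Polynomial.eval_mul, Polynomial.eval_pow, Polynomial.eval_sub, Polynomial.eval_X,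
          Polynomial.eval_one, norm_mul, norm_pow]
        rwa [← Complex.ofReal_one, ← Complex.ofReal_sub, Complex.norm_real, Complex.norm_real]) f
    simpa using this

end Network

/-! ### Elementary estimates for exponentials. -/

theorem norm_cexp_mul_I_sub_one_le (a : ℝ) : ‖Complex.exp (a * Complex.I) - 1‖ ≤ |a| := by
  rw [mul_comm]
  exact Real.norm_exp_I_mul_ofReal_sub_one_le

theorem norm_cexp_mul_I_sub_quadratic_le (a : ℝ) :
    ‖Complex.exp (a * Complex.I) - (1 + a * Complex.I - a ^ 2 / 2)‖ ≤ 4 * |a| ^ 3 := by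
  have hn : ‖(a : ℂ) * Complex.I‖ = |a| := by simp
  rcases le_total |a| 1 with h | h
  · have := Complex.exp_bound (x := a * Complex.I) (by rwa [hn]) (n := 3) (by norm_num)
    rw [hn] at this
    have e : ∑ k ∈ Finset.range 3, ((a : ℂ) * Complex.I) ^ k / (k.factorial : ℂ)
        = 1 + a * Complex.I - a ^ 2 / 2 := by
      simp [Finset.sum_range_succ, mul_pow, Nat.factorial]
      ring
    rw [e] at this
    refine this.trans ?_
    have h3 : 0 ≤ |a| ^ 3 := by positivity
    norm_num [Nat.factorial]
    linarith
  · have h1 := norm_cexp_mul_I_sub_one_le a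
    have h2 : ‖(a : ℂ) ^ 2 / 2‖ = |a| ^ 2 / 2 := by simp
    calc ‖Complex.exp (a * Complex.I) - (1 + a * Complex.I - a ^ 2 / 2)‖
        = ‖(Complex.exp (a * Complex.I) - 1) - a * Complex.I + a ^ 2 / 2‖ := by ring_nf
      _ ≤ ‖(Complex.exp (a * Complex.I) - 1) - a * Complex.I‖ + ‖(a : ℂ) ^ 2 / 2‖ := norm_add_le _ _
      _ ≤ ‖Complex.exp (a * Complex.I) - 1‖ + ‖a * Complex.I‖ + ‖(a : ℂ) ^ 2 / 2‖ := by
          gcongr; exact norm_sub_le _ _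
      _ ≤ |a| + |a| + |a| ^ 2 / 2 := by rw [hn, h2]; gcongr
      _ ≤ 4 * |a| ^ 3 := by
          have h3 : |a| ≤ |a| ^ 3 := le_self_pow₀ h (by norm_num)
          have h4 : |a| ^ 2 ≤ |a| ^ 3 := pow_le_pow_right₀ h (by norm_num)
          linarith

theorem abs_exp_neg_sub_le {x : ℝ} (hx : 0 ≤ x) : |1 - x - Real.exp (-x)| ≤ x ^ 2 := by
  have h1 := Real.add_one_le_exp (-x)
  rw [abs_of_nonpos (by linarith)]
  have h2 : Real.exp (-x) ≤ 1 / (1 + x) := by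
    rw [Real.exp_neg, ← one_div]
    exact one_div_le_one_div_of_le (by linarith) (by linarith [Real.add_one_le_exp x])
  have h3 : 1 / (1 + x) ≤ 1 - x + x ^ 2 := by
    rw [div_le_iff₀ (by linarith)]
    nlinarith [pow_nonneg hx 3]
  linarith

/-- In the diffusive variable `y = √n X` the bracket is `(y + y³ + 1/√n) / √n`, and half of the
Gaussian absorbs the polynomial in `y`. The three summands are the three kinds of error for the
powers of the twisted operator. -/
theorem add_pow_three_mul_exp_le {c : ℝ} (hc : 0 < c) {n : ℝ} (hn : 1 ≤ n) {X : ℝ} (hX : 0 ≤ X) :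
    (X + n * X ^ 3 + 1 / n) * Real.exp (-(c * n * X ^ 2))
      ≤ (3 + 16 / c ^ 2) / √n * Real.exp (-(c / 2 * n * X ^ 2)) := by
  have hn0 : 0 < n := by linarith
  have hs : 0 < √n := Real.sqrt_pos.2 hn0
  have hsq : √n ^ 2 = n := Real.sq_sqrt hn0.le
  set y := √n * X with hy
  have hy0 : 0 ≤ y := by positivity
  have hy2 : y ^ 2 = n * X ^ 2 := by rw [hy, mul_pow, hsq]
  have e1 : (X + n * X ^ 3 + 1 / n) = (y + y ^ 3 + 1 / √n) / √n := by
    rw [hy]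
    field_simp
    rw [hsq]
    ring
  have e2 : Real.exp (-(c * n * X ^ 2))
      = Real.exp (-(c / 2 * y ^ 2)) * Real.exp (-(c / 2 * n * X ^ 2)) := by
    rw [← Real.exp_add, hy2]
    ring_nf
  have e3 : 1 / √n ≤ 1 := by
    rw [div_le_one hs]
    exact Real.one_le_sqrt.2 hn
  have e4 : (y + y ^ 3 + 1 / √n) ≤ 3 + 2 * y ^ 4 := by
    have : y + y ^ 3 ≤ 2 + 2 * y ^ 4 := by
      rcases le_total y 1 with h | h
      · have : y ^ 3 ≤ 1 := pow_le_one₀ hy0 h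
        have : 0 ≤ y ^ 4 := by positivity
        linarith
      · have h4 : y ^ 3 ≤ y ^ 4 := pow_le_pow_right₀ h (by norm_num)
        have h5 : y ≤ y ^ 4 := le_self_pow₀ h (by norm_num)
        linarith
    linarith
  have e5 : (3 + 2 * y ^ 4) * Real.exp (-(c / 2 * y ^ 2)) ≤ 3 + 16 / c ^ 2 := by
    have ht : 0 ≤ c / 2 * y ^ 2 := by positivity
    have hq := Real.quadratic_le_exp_of_nonneg ht
    rw [Real.exp_neg, ← div_eq_mul_inv, div_le_iff₀ (Real.exp_pos _)]
    have h1 : 1 ≤ Real.exp (c / 2 * y ^ 2) := Real.one_le_exp ht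
    have h2 : 2 * y ^ 4 ≤ 16 / c ^ 2 * Real.exp (c / 2 * y ^ 2) := by
      calc 2 * y ^ 4 = 16 / c ^ 2 * ((c / 2 * y ^ 2) ^ 2 / 2) := by field_simp; ring
        _ ≤ _ := by gcongr; linarith
    linarith
  rw [e1, e2]
  calc (y + y ^ 3 + 1 / √n) / √n *
        (Real.exp (-(c / 2 * y ^ 2)) * Real.exp (-(c / 2 * n * X ^ 2)))
      ≤ (3 + 2 * y ^ 4) / √n *
        (Real.exp (-(c / 2 * y ^ 2)) * Real.exp (-(c / 2 * n * X ^ 2))) := by gcongr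
    _ = ((3 + 2 * y ^ 4) * Real.exp (-(c / 2 * y ^ 2))) / √n *
        Real.exp (-(c / 2 * n * X ^ 2)) := by ring
    _ ≤ _ := by gcongr

theorem norm_le_card_mul {V : Type*} [Fintype V] {f : EuclideanSpace ℂ V} {B : ℝ} (hB : 0 ≤ B)
    (h : ∀ x, ‖f x‖ ≤ B) : ‖f‖ ≤ Fintype.card V * B := by
  refine le_of_sq_le_sq ?_ (by positivity)
  rw [EuclideanSpace.norm_sq_eq]
  calc ∑ x, ‖f x‖ ^ 2 ≤ ∑ _x : V, B ^ 2 := by gcongr with x; exact h x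
    _ = Fintype.card V * B ^ 2 := by simp
    _ ≤ (Fintype.card V : ℝ) ^ 2 * B ^ 2 := by
        gcongr
        exact_mod_cast Nat.le_self_pow (by norm_num) _
    _ = _ := by ring

/-! ### Correctors and approximate eigenvectors of the twisted operators. -/

namespace Network

variable {N : Network} {δ : ℝ}

/-- The energy detects non-constant functions: the network is connected. -/
def IsConnected (N : Network) : Prop := ∀ f, N.energy 0 f = 0 → ∀ x y, f x = f y

open Classical in
/-- Solvability of the Poisson equation. -/
theorem IsConnected.exists_sub_transfer_eq (hc : N.IsConnected) (h : N.IsUniform) (z : N.V) :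
    ∃ g, g - N.transfer 0 g = EuclideanSpace.single z 1
      - WithLp.toLp 2 (fun _ => (Fintype.card N.V : ℂ)⁻¹) := by
  set T : EuclideanSpace ℂ N.V →ₗ[ℂ] EuclideanSpace ℂ N.V := 1 - N.transfer 0 with hT
  have hTs : T.IsSymmetric := LinearMap.IsSymmetric.one.sub (N.transfer_isSymmetric 0)
  -- The operator `1 - N.transfer 0` is symmetric, so its range is the orthogonal complement of its
  -- kernel. By connectedness the kernel consists of constants, to which a point mass minus its mean
  -- is orthogonal.
  have hmem : EuclideanSpace.single z 1 - WithLp.toLp 2 (fun _ => (Fintype.card N.V : ℂ)⁻¹)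
      ∈ LinearMap.range T := by
    rw [← Submodule.orthogonal_orthogonal (LinearMap.range T), hTs.orthogonal_range,
      Submodule.mem_orthogonal]
    intro v hv
    have hv' : N.transfer 0 v = v := by
      have : v - N.transfer 0 v = 0 := hv
      exact (sub_eq_zero.1 this).symm
    have hconst := hc v (by
      rw [h.energy_eq, hv', inner_self_eq_norm_sq_to_K]
      simp [← Complex.ofReal_pow])
    have : (Fintype.card N.V : ℂ) ≠ 0 := by
      have : Nonempty N.V := ⟨z⟩
      exact_mod_cast Fintype.card_ne_zero
    rw [inner_sub_right, EuclideanSpace.inner_single_right, PiLp.inner_apply]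
    simp only [RCLike.inner_apply, hconst _ z]
    simp [this]
  obtain ⟨g, hg⟩ := hmem
  exact ⟨g, hg⟩

/-- Harmonicity in probabilistic form: under one step from any vertex, `u` has mean zero. -/
theorem IsUniform.sum_prob_mul_eq_zero (h : N.IsUniform) {u : N.OneForm}
    (hu : ∀ x, N.dStar u x = 0) (x : N.V) : ∑ e ∈ N.edgesFrom x, N.prob e * u.1 e = 0 := by
  have := hu x
  rw [dStar, neg_eq_zero] at this
  rw [← this]
  refine Finset.sum_congr rfl fun e _ => ?_
  rw [h x, prob]
  field_simp

theorem transfer_zero_apply (g : EuclideanSpace ℂ N.V) (x : N.V) :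
    N.transfer 0 g x = ∑ e ∈ N.edgesFrom x, (N.prob e : ℂ) * g (N.ter e) := by
  simp [transfer_apply]

theorem IsUniform.norm_sum_prob_mul_le (h : N.IsUniform) (x : N.V) {G : N.E → ℂ} {B : ℝ}
    (hG : ∀ e, ‖G e‖ ≤ B) : ‖∑ e ∈ N.edgesFrom x, (N.prob e : ℂ) * G e‖ ≤ B := by
  calc ‖∑ e ∈ N.edgesFrom x, (N.prob e : ℂ) * G e‖
      ≤ ∑ e ∈ N.edgesFrom x, N.prob e * B := by
        refine norm_sum_le_of_le _ fun e _ => ?_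
        rw [norm_mul, Complex.norm_real, Real.norm_of_nonneg (N.prob_nonneg e)]
        exact mul_le_mul_of_nonneg_left (hG e) (N.prob_nonneg e)
    _ = B := by rw [← Finset.sum_mul, h.sum_prob, one_mul]

/-- The function `exp (- i φ) (1 + g)` is an approximate eigenvector, if `φ` and `g` are the first
and second order correctors. -/
theorem IsUniform.norm_transfer_sub_smul_le (h : N.IsUniform) {ω u : N.OneForm} {φ : N.V → ℝ}
    (hω : u + N.d φ = ω) (hu : ∀ x, N.dStar u x = 0) {g : EuclideanSpace ℂ N.V} {q a b : ℝ}
    (hq : 0 ≤ q) (ha : ∀ e, |u.1 e| ≤ a) (hb : ∀ x, ‖g x‖ ≤ b)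
    (hg : ∀ x, (g - N.transfer 0 g) x
      = q - ((1 / 2 * ∑ e ∈ N.edgesFrom x, N.prob e * u.1 e ^ 2 : ℝ) : ℂ)) (x : N.V) :
    ‖(N.transfer ω (WithLp.toLp 2 fun y => Complex.exp (-(φ y * Complex.I)) * (1 + g y))
      - (Real.exp (-q) : ℂ) •
        (WithLp.toLp 2 fun y => Complex.exp (-(φ y * Complex.I)) * (1 + g y))) x‖
      ≤ 4 * a ^ 3 + a * b + q ^ 2 + q * b := by
  have hne : (N.edgesFrom x).Nonempty := by
    rw [Finset.nonempty_iff_ne_empty]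
    intro h0
    have := h.sum_prob x
    simp [h0] at this
  obtain ⟨e₀, -⟩ := hne
  have ha0 : 0 ≤ a := (abs_nonneg _).trans (ha e₀)
  have hb0 : 0 ≤ b := (norm_nonneg _).trans (hb x)
  have hωe : ∀ e ∈ N.edgesFrom x, ω.1 e = u.1 e + (φ (N.ter e) - φ x) := by
    intro e he
    rw [← hω, ← N.mem_edgesFrom.1 he]
    rfl
  -- Gauge invariance: conjugation by `exp (-iφ)` removes the exact part of `ω` and leaves `u`.
  have hexp : ∀ e ∈ N.edgesFrom x, Complex.exp (ω.1 e * Complex.I) *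
      (Complex.exp (-(φ (N.ter e) * Complex.I)) * (1 + g (N.ter e)))
      = Complex.exp (-(φ x * Complex.I)) * (Complex.exp (u.1 e * Complex.I) * (1 + g (N.ter e))) := by
    intro e he
    rw [hωe e he, ← mul_assoc, ← mul_assoc, ← Complex.exp_add, ← Complex.exp_add]
    congr 2
    push_cast
    ring
  have hu0 : ∑ e ∈ N.edgesFrom x, (N.prob e : ℂ) * (u.1 e * Complex.I) = 0 := by
    have := h.sum_prob_mul_eq_zero hu x
    simp only [← mul_assoc, ← Finset.sum_mul]
    have h' : ∑ e ∈ N.edgesFrom x, (N.prob e : ℂ) * (u.1 e : ℂ) = 0 := by exact_mod_cast this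
    rw [h', zero_mul]
  have h1 : ∑ e ∈ N.edgesFrom x, (N.prob e : ℂ) = 1 := by exact_mod_cast h.sum_prob x
  have hgx := hg x
  rw [PiLp.sub_apply, transfer_zero_apply] at hgx
  -- In the second order expansion of `exp (iu)`, the linear term has mean zero, and by `hg` the
  -- quadratic term combines with `g - N.transfer 0 g` to the constant `q`. The four remaining terms
  -- are bounded by `4a³`, `ab`, `q²` and `qb`.
  have hkey : ∑ e ∈ N.edgesFrom x, (N.prob e : ℂ) *
      (Complex.exp (u.1 e * Complex.I) * (1 + g (N.ter e)))
      - Real.exp (-q) * (1 + g x)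
      = ∑ e ∈ N.edgesFrom x, (N.prob e : ℂ) *
          (Complex.exp (u.1 e * Complex.I) - (1 + u.1 e * Complex.I - (u.1 e) ^ 2 / 2))
        + ∑ e ∈ N.edgesFrom x, (N.prob e : ℂ) *
          ((Complex.exp (u.1 e * Complex.I) - 1) * g (N.ter e))
        + ((1 - q - Real.exp (-q) : ℝ) : ℂ) + ((1 - Real.exp (-q) : ℝ) : ℂ) * g x := by
    have hsplit : ∑ e ∈ N.edgesFrom x, (N.prob e : ℂ) *
        (Complex.exp (u.1 e * Complex.I) * (1 + g (N.ter e)))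
        = ∑ e ∈ N.edgesFrom x, (N.prob e : ℂ) *
          (Complex.exp (u.1 e * Complex.I) - (1 + u.1 e * Complex.I - (u.1 e) ^ 2 / 2))
        + ∑ e ∈ N.edgesFrom x, (N.prob e : ℂ) *
          ((Complex.exp (u.1 e * Complex.I) - 1) * g (N.ter e))
        + ∑ e ∈ N.edgesFrom x, (N.prob e : ℂ)
        + ∑ e ∈ N.edgesFrom x, (N.prob e : ℂ) * (u.1 e * Complex.I)
        + ∑ e ∈ N.edgesFrom x, (N.prob e : ℂ) * g (N.ter e)
        - 1 / 2 * ∑ e ∈ N.edgesFrom x, (N.prob e : ℂ) * (u.1 e : ℂ) ^ 2 := by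
      rw [Finset.mul_sum, ← Finset.sum_add_distrib, ← Finset.sum_add_distrib,
        ← Finset.sum_add_distrib, ← Finset.sum_add_distrib, ← Finset.sum_sub_distrib]
      refine Finset.sum_congr rfl fun e _ => ?_
      ring
    push_cast at hgx ⊢
    rw [hsplit, hu0, h1]
    linear_combination -hgx
  have hLHS : (N.transfer ω (WithLp.toLp 2 fun y => Complex.exp (-(φ y * Complex.I)) * (1 + g y))
      - (Real.exp (-q) : ℂ) •
        (WithLp.toLp 2 fun y => Complex.exp (-(φ y * Complex.I)) * (1 + g y))) x
      = Complex.exp (-(φ x * Complex.I)) * (∑ e ∈ N.edgesFrom x, (N.prob e : ℂ) *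
      (Complex.exp (u.1 e * Complex.I) * (1 + g (N.ter e)))
      - Real.exp (-q) * (1 + g x)) := by
    rw [PiLp.sub_apply, transfer_apply, PiLp.smul_apply, smul_eq_mul, mul_sub, Finset.mul_sum]
    congr 1
    · refine Finset.sum_congr rfl fun e he => ?_
      rw [hexp e he]
      ring
    · ring
  have hnexp : ‖Complex.exp (-(φ x * Complex.I))‖ = 1 := by
    rw [← neg_mul, ← Complex.ofReal_neg, Complex.norm_exp_ofReal_mul_I]
  rw [hLHS, norm_mul, hnexp, one_mul, hkey]
  refine (norm_add_le _ _).trans (add_le_add ((norm_add_le _ _).trans (add_le_add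
    ((norm_add_le _ _).trans (add_le_add ?_ ?_)) ?_)) ?_)
  · refine h.norm_sum_prob_mul_le x fun e => (norm_cexp_mul_I_sub_quadratic_le _).trans ?_
    gcongr
    exact ha e
  · refine h.norm_sum_prob_mul_le x fun e => ?_
    rw [norm_mul]
    gcongr
    · exact (norm_cexp_mul_I_sub_one_le _).trans (ha e)
    · exact hb _
  · rw [Complex.norm_real]
    exact abs_exp_neg_sub_le hq
  · rw [norm_mul, Complex.norm_real, Real.norm_eq_abs]
    gcongr
    · have h1 := Real.add_one_le_exp (-q)
      have h2 : Real.exp (-q) ≤ 1 := Real.exp_le_one_iff.2 (by linarith)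
      rw [abs_of_nonneg (by linarith)]
      linarith
    · exact hb x

end Network

/-- Powers of an operator on an approximate eigenvector. -/
theorem norm_pow_sub_smul_le {H : Type*} [NormedAddCommGroup H] [NormedSpace ℂ H] (T : H →ₗ[ℂ] H)
    {t ρ r : ℝ} (ht : |t| ≤ ρ) (hT : ∀ (n : ℕ) (v : H), ‖(T ^ n) v‖ ≤ ρ ^ n * ‖v‖) {v : H}
    (hv : ‖T v - (t : ℂ) • v‖ ≤ r) (n : ℕ) :
    ‖(T ^ n) v - ((t ^ n : ℝ) : ℂ) • v‖ * ρ ≤ n * ρ ^ n * r := by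
  have hρ : 0 ≤ ρ := (abs_nonneg _).trans ht
  induction n with
  | zero => simp
  | succ n ih =>
    -- One telescoping step. The factor `ρ` on the left of the claim avoids the exponent `n - 1`.
    have e : (T ^ (n + 1)) v - ((t ^ (n + 1) : ℝ) : ℂ) • v
        = (T ^ n) (T v - (t : ℂ) • v) + (t : ℂ) • ((T ^ n) v - ((t ^ n : ℝ) : ℂ) • v) := by
      rw [map_sub, map_smul, smul_sub, smul_smul, pow_succ, Module.End.mul_apply]
      push_cast
      rw [pow_succ, mul_comm (t : ℂ)]
      abel
    calc ‖(T ^ (n + 1)) v - ((t ^ (n + 1) : ℝ) : ℂ) • v‖ * ρ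
        ≤ (ρ ^ n * r + ρ * ‖(T ^ n) v - ((t ^ n : ℝ) : ℂ) • v‖) * ρ := by
          gcongr
          rw [e]
          refine (norm_add_le _ _).trans (add_le_add ?_ ?_)
          · exact (hT n _).trans (by gcongr)
          · rw [norm_smul, Complex.norm_real]
            gcongr
            exact ht
      _ = ρ ^ (n + 1) * r + ρ * (‖(T ^ n) v - ((t ^ n : ℝ) : ℂ) • v‖ * ρ) := by ring
      _ ≤ ρ ^ (n + 1) * r + ρ * (n * ρ ^ n * r) := by gcongr
      _ = _ := by push_cast; ring

/-- Linear families of functions on a finite set are bounded by a multiple of the parameter. -/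
theorem exists_abs_apply_le {E ι : Type*} [NormedAddCommGroup E] [NormedSpace ℝ E]
    [FiniteDimensional ℝ E] [Fintype ι] (L : E →ₗ[ℝ] (ι → ℝ)) :
    ∃ K : ℝ, 0 < K ∧ ∀ θ i, |L θ i| ≤ K * ‖θ‖ := by
  obtain ⟨K, hK, h⟩ := (LinearMap.toContinuousLinearMap L).bound
  exact ⟨K, hK, fun θ i => (norm_le_pi_norm (L θ) i).trans (h θ)⟩

namespace Network

variable {N : Network} {δ : ℝ}

/-- Superposes the solutions for point sources, with minus the halved local variances of `u` as
weights. The mean of these halved variances over the vertices is the halved total `1 / 2 * ∑ u² c`,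
because `prob` is `c` times the number of vertices. -/
theorem corrector_sub_transfer_eq (u : N.OneForm) (g : N.V → EuclideanSpace ℂ N.V)
    (hg : ∀ z, g z - N.transfer 0 (g z) = (open Classical in EuclideanSpace.single z 1)
      - WithLp.toLp 2 (fun _ => (Fintype.card N.V : ℂ)⁻¹)) (x : N.V) :
    (-(∑ z, ((1 / 2 * ∑ e ∈ N.edgesFrom z, N.prob e * u.1 e ^ 2 : ℝ) : ℂ) • g z)
      - N.transfer 0 (-(∑ z, ((1 / 2 * ∑ e ∈ N.edgesFrom z, N.prob e * u.1 e ^ 2 : ℝ) : ℂ) • g z))) x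
      = ((1 / 2 * ∑ e, u.1 e ^ 2 * N.c e : ℝ) : ℂ)
        - ((1 / 2 * ∑ e ∈ N.edgesFrom x, N.prob e * u.1 e ^ 2 : ℝ) : ℂ) := by
  classical
  have : Nonempty N.V := ⟨x⟩
  have hcard : (Fintype.card N.V : ℝ) ≠ 0 := by exact_mod_cast Fintype.card_ne_zero
  set q : N.V → ℝ := fun z => 1 / 2 * ∑ e ∈ N.edgesFrom z, N.prob e * u.1 e ^ 2 with hq
  have hsum : ∑ z, q z * (Fintype.card N.V : ℝ)⁻¹ = 1 / 2 * ∑ e, u.1 e ^ 2 * N.c e := by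
    rw [← Finset.sum_mul, hq, ← Finset.mul_sum, N.sum_edgesFrom, mul_assoc, Finset.sum_mul]
    congr 1
    refine Finset.sum_congr rfl fun e _ => ?_
    rw [prob]
    field_simp
  have e1 : -(∑ z, (q z : ℂ) • g z) - N.transfer 0 (-(∑ z, (q z : ℂ) • g z))
      = -∑ z, (q z : ℂ) • (EuclideanSpace.single z 1
        - WithLp.toLp 2 (fun _ => (Fintype.card N.V : ℂ)⁻¹)) := by
    simp only [map_neg, map_sum, map_smul, sub_neg_eq_add]
    rw [neg_add_eq_sub, ← neg_sub, ← Finset.sum_sub_distrib]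
    congr 1
    refine Finset.sum_congr rfl fun z _ => ?_
    rw [← smul_sub, hg z]
  rw [e1, ← hsum]
  simp [mul_sub, Finset.sum_sub_distrib, Pi.single_apply, hq]

set_option maxHeartbeats 1000000 in
open Classical in
/-- The Gaussian approximation of the powers of the transition operator. -/
theorem IsUniform.norm_transfer_pow_single_sub_le (h : N.IsUniform) (hδ : 0 < δ)
    (hl : N.IsLazy δ) (hconn : N.IsConnected) [Nonempty N.V]
    {E : Type*} [NormedAddCommGroup E] [InnerProductSpace ℝ E] [FiniteDimensional ℝ E]
    (Ω U : E →ₗ[ℝ] N.OneForm) (f : E →ₗ[ℝ] (N.V → ℝ)) (hUf : ∀ θ, U θ + N.d (f θ) = Ω θ)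
    (hU : ∀ θ x, N.dStar (U θ) x = 0) {D : Set E} {R : ℝ} (hD : ∀ θ ∈ D, ‖θ‖ ≤ R)
    {c₀ c₁ : ℝ} (hc₀ : 0 < c₀) (hc₁ : 0 < c₁)
    (hgap : ∀ θ ∈ D, ∀ v, c₀ * ‖θ‖ ^ 2 * ‖v‖ ^ 2 ≤ N.energy (Ω θ) v)
    (hpos : ∀ θ, c₁ * ‖θ‖ ^ 2 ≤ ∑ e, (U θ).1 e ^ 2 * N.c e) :
    ∃ C c : ℝ, 0 < C ∧ 0 < c ∧ ∀ θ ∈ D, ∀ n : ℕ, 0 < n → ∀ x z : N.V,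
      ‖(N.transfer (Ω θ) ^ n) (EuclideanSpace.single z 1) x
        - ((Fintype.card N.V : ℝ)⁻¹ * Real.exp (-(n * (1 / 2 * ∑ e, (U θ).1 e ^ 2 * N.c e))) : ℝ)‖
      ≤ C / √n * Real.exp (-(c * n * ‖θ‖ ^ 2)) := by
  obtain ⟨R, hR0, hD⟩ : ∃ R', 0 < R' ∧ ∀ θ ∈ D, ‖θ‖ ≤ R' :=
    ⟨max R 1, by positivity, fun θ hθ => (hD θ hθ).trans (le_max_left _ _)⟩
  choose g hg using hconn.exists_sub_transfer_eq h
  obtain ⟨KU, hKU, hKU'⟩ := exists_abs_apply_le (N.OneForm.subtype ∘ₗ U)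
  obtain ⟨KΩ, hKΩ, hKΩ'⟩ := exists_abs_apply_le (N.OneForm.subtype ∘ₗ Ω)
  obtain ⟨Kf, hKf, hKf'⟩ := exists_abs_apply_le f
  obtain ⟨ca, Ca, hca, hCa, hbounds⟩ :=
    h.pow_transfer_bounds hδ hl (R := c₀ * R ^ 2) (by positivity)
  set Kq : ℝ := 1 / 2 * ∑ e, KU ^ 2 * N.c e with hKq
  have hKq0 : 0 ≤ Kq := mul_nonneg (by norm_num)
    (Finset.sum_nonneg fun e _ => mul_nonneg (by positivity) (N.c_pos e).le)
  set G : ℝ := ∑ z, ‖g z‖ with hG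
  have hG0 : 0 ≤ G := Finset.sum_nonneg fun z _ => norm_nonneg _
  set Kg : ℝ := 1 / 2 * KU ^ 2 * G with hKg
  have hKg0 : 0 ≤ Kg := by positivity
  set V : ℝ := (Fintype.card N.V : ℝ) with hV
  have hV0 : 0 < V := by
    rw [hV]
    exact_mod_cast Fintype.card_pos
  -- A common Gaussian rate: `ca * c₀` comes from the powers of the operator, `c₁ / 2` from `exp
  -- (-q)`.
  set c : ℝ := min (ca * c₀) (c₁ / 2) with hc
  have hc0 : 0 < c := by positivity
  -- the error terms
  set K1 : ℝ := Kf + Kg * R with hK1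
  set K3 : ℝ := 4 * KU ^ 3 + KU * Kg + (Kq ^ 2 + Kq * Kg) * R with hK3
  -- `A1`, `A3` and `A0` are the coefficients of `X`, `n X³` and `1 / n` in the final bound, where
  -- `X = ‖θ‖`.
  set A1 : ℝ := K1 + V * K1 + KΩ * G * V with hA1
  set A3 : ℝ := V * K3 * Real.exp (c * R ^ 2) with hA3
  set A0 : ℝ := Ca * G with hA0
  have hK10 : 0 ≤ K1 := by positivity
  have hK30 : 0 ≤ K3 := by positivity
  have hA10 : 0 ≤ A1 := by positivity
  have hA30 : 0 ≤ A3 := by positivity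
  have hA00 : 0 ≤ A0 := by positivity
  refine ⟨(A1 + A3 + A0 + 1) * (3 + 16 / c ^ 2), c / 2, by positivity, by positivity, ?_⟩
  intro θ hθ n hn x z
  have hn1 : (1 : ℝ) ≤ n := by exact_mod_cast hn
  have hn0 : (0 : ℝ) < n := by linarith
  set X : ℝ := ‖θ‖ with hX
  have hX0 : 0 ≤ X := norm_nonneg _
  have hXR : X ≤ R := hD θ hθ
  set M := N.transfer (Ω θ) with hM
  set q : ℝ := 1 / 2 * ∑ e, (U θ).1 e ^ 2 * N.c e with hq
  have hUe : ∀ e, |(U θ).1 e| ≤ KU * X := fun e => hKU' θ e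
  have hUsq : ∀ e, (U θ).1 e ^ 2 ≤ KU ^ 2 * X ^ 2 := by
    intro e
    rw [← mul_pow, ← sq_abs]
    exact pow_le_pow_left₀ (abs_nonneg _) (hUe e) 2
  have hqX : q ≤ Kq * X ^ 2 := by
    rw [hq, hKq, mul_assoc, Finset.sum_mul]
    refine mul_le_mul_of_nonneg_left (Finset.sum_le_sum fun e _ => ?_) (by norm_num)
    rw [mul_right_comm]
    exact mul_le_mul_of_nonneg_right (hUsq e) (N.c_pos e).le
  have hqc : c * X ^ 2 ≤ q := by
    have h1 := hpos θ
    have h2 : c * X ^ 2 ≤ c₁ / 2 * X ^ 2 := by gcongr; exact min_le_right _ _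
    rw [hq]
    linarith
  have hq0 : 0 ≤ q := le_trans (by positivity) hqc
  have hExp : ∀ k : ℕ, Real.exp (-(ca * k * (c₀ * X ^ 2))) ≤ Real.exp (-(c * k * X ^ 2)) := by
    intro k
    rw [Real.exp_le_exp, neg_le_neg_iff]
    calc c * k * X ^ 2 ≤ (ca * c₀) * k * X ^ 2 := by gcongr; exact min_le_left _ _
      _ = _ := by ring
  have hb := hbounds (Ω θ) (c₀ * X ^ 2) (by positivity) (by gcongr) (hgap θ hθ)
  have hpow : ∀ (k : ℕ) (v : EuclideanSpace ℂ N.V),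
      ‖(M ^ k) v‖ ≤ Real.exp (-(c * k * X ^ 2)) * ‖v‖ := by
    intro k v
    rcases Nat.eq_zero_or_pos k with rfl | hk
    · simp
    · exact (hb k hk v).1.trans (mul_le_mul_of_nonneg_right (hExp k) (norm_nonneg _))
  set ρ := Real.exp (-(c * X ^ 2)) with hρ
  have hρpow : ∀ k : ℕ, ρ ^ k = Real.exp (-(c * k * X ^ 2)) := by
    intro k
    rw [hρ, ← Real.exp_nat_mul]
    ring_nf
  -- the approximate eigenvector
  set γ : EuclideanSpace ℂ N.V :=
    -(∑ z, ((1 / 2 * ∑ e ∈ N.edgesFrom z, N.prob e * (U θ).1 e ^ 2 : ℝ) : ℂ) • g z) with hγ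
  have hγX : ∀ y, ‖γ y‖ ≤ Kg * X ^ 2 := by
    intro y
    refine (PiLp.norm_apply_le γ y).trans ?_
    rw [hγ, norm_neg, hKg, hG, mul_assoc, mul_assoc, mul_comm (∑ z, ‖g z‖), ← mul_assoc,
      ← mul_assoc, Finset.mul_sum]
    refine norm_sum_le_of_le _ fun y _ => ?_
    rw [norm_smul]
    gcongr
    rw [Complex.norm_real, Real.norm_eq_abs, abs_of_nonneg (mul_nonneg (by norm_num)
      (Finset.sum_nonneg fun e _ => mul_nonneg (N.prob_nonneg e) (sq_nonneg _))), mul_assoc]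
    gcongr
    calc ∑ e ∈ N.edgesFrom y, N.prob e * (U θ).1 e ^ 2
        ≤ ∑ e ∈ N.edgesFrom y, N.prob e * (KU ^ 2 * X ^ 2) :=
          Finset.sum_le_sum fun e _ => mul_le_mul_of_nonneg_left (hUsq e) (N.prob_nonneg e)
      _ = KU ^ 2 * X ^ 2 := by rw [← Finset.sum_mul, h.sum_prob, one_mul]
  set η : EuclideanSpace ℂ N.V :=
    WithLp.toLp 2 fun y => Complex.exp (-((f θ y : ℂ) * Complex.I)) * (1 + γ y) with hη
  set one : EuclideanSpace ℂ N.V := WithLp.toLp 2 fun _ => (1 : ℂ) with hone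
  have hηone : ‖η - one‖ ≤ V * (K1 * X) := by
    refine norm_le_card_mul (by positivity) fun y => ?_
    have e1 : (η - one) y = (Complex.exp (((-(f θ y) : ℝ) : ℂ) * Complex.I) - 1)
        + Complex.exp (((-(f θ y) : ℝ) : ℂ) * Complex.I) * γ y := by
      rw [hη, hone, PiLp.sub_apply]
      push_cast
      ring_nf
    rw [e1]
    calc _ ≤ Kf * X + Kg * X ^ 2 := by
          refine (norm_add_le _ _).trans (add_le_add ?_ ?_)
          · refine (norm_cexp_mul_I_sub_one_le _).trans ?_
            rw [abs_neg]
            exact hKf' θ y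
          · rw [norm_mul, Complex.norm_exp_ofReal_mul_I, one_mul]
            exact hγX y
      _ ≤ Kf * X + Kg * (R * X) := by rw [pow_two]; gcongr
      _ = K1 * X := by rw [hK1]; ring
  have hres : ‖M η - (Real.exp (-q) : ℂ) • η‖ ≤ V * (K3 * X ^ 3) := by
    refine norm_le_card_mul (by positivity) fun y => ?_
    refine (h.norm_transfer_sub_smul_le (hUf θ) (hU θ) hq0 hUe hγX
      (corrector_sub_transfer_eq (U θ) g fun z => by rw [hg z]) y).trans ?_
    calc 4 * (KU * X) ^ 3 + KU * X * (Kg * X ^ 2) + q ^ 2 + q * (Kg * X ^ 2)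
        ≤ 4 * (KU * X) ^ 3 + KU * X * (Kg * X ^ 2) + (Kq * X ^ 2) ^ 2
          + (Kq * X ^ 2) * (Kg * X ^ 2) := by gcongr
      _ = (4 * KU ^ 3 + KU * Kg) * X ^ 3 + (Kq ^ 2 + Kq * Kg) * (X * X ^ 3) := by ring
      _ ≤ (4 * KU ^ 3 + KU * Kg) * X ^ 3 + (Kq ^ 2 + Kq * Kg) * (R * X ^ 3) := by gcongr
      _ = K3 * X ^ 3 := by rw [hK3]; ring
  have hmain : ‖(M ^ n) η - ((Real.exp (-q) ^ n : ℝ) : ℂ) • η‖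
      ≤ A3 * (n * X ^ 3) * Real.exp (-(c * n * X ^ 2)) := by
    have h1 := norm_pow_sub_smul_le M (t := Real.exp (-q)) (ρ := ρ)
      (by rw [abs_of_pos (Real.exp_pos _), hρ, Real.exp_le_exp]; linarith)
      (fun k v => by rw [hρpow]; exact hpow k v) hres n
    -- The missing power of `ρ` costs only a constant, since `‖θ‖ ≤ R`.
    have h2 : 1 ≤ ρ * Real.exp (c * R ^ 2) := by
      rw [hρ, ← Real.exp_add]
      apply Real.one_le_exp
      have : c * X ^ 2 ≤ c * R ^ 2 := by gcongr
      linarith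
    calc _ ≤ ‖(M ^ n) η - ((Real.exp (-q) ^ n : ℝ) : ℂ) • η‖ * (ρ * Real.exp (c * R ^ 2)) :=
          le_mul_of_one_le_right (norm_nonneg _) h2
      _ = ‖(M ^ n) η - ((Real.exp (-q) ^ n : ℝ) : ℂ) • η‖ * ρ * Real.exp (c * R ^ 2) := by ring
      _ ≤ n * ρ ^ n * (V * (K3 * X ^ 3)) * Real.exp (c * R ^ 2) := by gcongr
      _ = _ := by rw [hρpow, hA3]; ring
  have hqn : Real.exp (-q) ^ n ≤ Real.exp (-(c * n * X ^ 2)) := by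
    rw [← hρpow, hρ]
    gcongr
  -- the remainder terms
  have hP : ‖M (g z) - N.transfer 0 (g z)‖ ≤ V * (KΩ * X * G) := by
    refine norm_le_card_mul (by positivity) fun y => ?_
    have e1 : (M (g z) - N.transfer 0 (g z)) y = ∑ e ∈ N.edgesFrom y, (N.prob e : ℂ) *
        ((Complex.exp ((Ω θ).1 e * Complex.I) - 1) * g z (N.ter e)) := by
      rw [PiLp.sub_apply, transfer_zero_apply, hM, transfer_apply,
        ← Finset.sum_sub_distrib]
      refine Finset.sum_congr rfl fun e _ => ?_
      ring
    rw [e1]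
    refine h.norm_sum_prob_mul_le y fun e => ?_
    rw [norm_mul]
    gcongr
    · exact (norm_cexp_mul_I_sub_one_le _).trans (hKΩ' θ e)
    · exact (PiLp.norm_apply_le _ _).trans
        (Finset.single_le_sum (f := fun z => ‖g z‖) (fun _ _ => norm_nonneg _) (Finset.mem_univ z))
  have hgz : ‖g z‖ ≤ G :=
    Finset.single_le_sum (f := fun z => ‖g z‖) (fun _ _ => norm_nonneg _) (Finset.mem_univ z)
  have hV1 : ‖(V : ℂ)⁻¹‖ ≤ 1 := by
    rw [norm_inv, Complex.norm_real, Real.norm_of_nonneg hV0.le]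
    refine inv_le_one_of_one_le₀ ?_
    rw [hV]
    exact_mod_cast Fintype.card_pos
  have hVV : ‖(V : ℂ)⁻¹‖ * V = 1 := by
    rw [norm_inv, Complex.norm_real, Real.norm_of_nonneg hV0.le]
    field_simp
  -- The point mass is `V⁻¹ • one + (g z - M (g z)) + (M (g z) - N.transfer 0 (g z))`, and `one = η
  -- - (η - one)`. Up to the Gaussian factor, the five terms are of order `X`, `n X³`, `X`, `1 / n`
  -- and `X`.
  have hdecomp : (M ^ n) (EuclideanSpace.single z 1) - ((V⁻¹ * Real.exp (-q) ^ n : ℝ) : ℂ) • one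
      = (V : ℂ)⁻¹ • (-(M ^ n) (η - one)) + (V : ℂ)⁻¹ • ((M ^ n) η - ((Real.exp (-q) ^ n : ℝ) : ℂ) • η)
        + (V : ℂ)⁻¹ • (((Real.exp (-q) ^ n : ℝ) : ℂ) • (η - one))
        + (M ^ n) (g z - M (g z)) + (M ^ n) (M (g z) - N.transfer 0 (g z)) := by
    have e1 : EuclideanSpace.single z (1 : ℂ)
        = (V : ℂ)⁻¹ • one + (g z - M (g z)) + (M (g z) - N.transfer 0 (g z)) := by
      rw [add_assoc, sub_add_sub_cancel, hg z]
      ext y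
      simp [hone, hV]
    rw [e1]
    simp only [map_add, map_sub, map_smul, smul_sub, smul_neg, smul_smul]
    push_cast
    abel
  have hentry : (M ^ n) (EuclideanSpace.single z 1) x
        - ((V⁻¹ * Real.exp (-(n * q)) : ℝ) : ℂ)
      = ((M ^ n) (EuclideanSpace.single z 1) - ((V⁻¹ * Real.exp (-q) ^ n : ℝ) : ℂ) • one) x := by
    rw [← Real.exp_nat_mul, mul_neg]
    simp [hone]
  rw [hentry]
  refine (PiLp.norm_apply_le _ x).trans ?_
  rw [hdecomp]
  calc _ ≤ K1 * X * Real.exp (-(c * n * X ^ 2))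
        + A3 * (n * X ^ 3) * Real.exp (-(c * n * X ^ 2))
        + V * K1 * X * Real.exp (-(c * n * X ^ 2))
        + A0 * (1 / n) * Real.exp (-(c * n * X ^ 2))
        + KΩ * G * V * X * Real.exp (-(c * n * X ^ 2)) := by
        refine (norm_add_le _ _).trans (add_le_add ((norm_add_le _ _).trans (add_le_add
          ((norm_add_le _ _).trans (add_le_add ((norm_add_le _ _).trans (add_le_add ?_ ?_)) ?_))
          ?_)) ?_)
        · rw [norm_smul, norm_neg]
          calc _ ≤ ‖(V : ℂ)⁻¹‖ * (Real.exp (-(c * n * X ^ 2)) * (V * (K1 * X))) := by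
                gcongr
                exact (hpow n _).trans (by gcongr)
            _ = (‖(V : ℂ)⁻¹‖ * V) * (K1 * X * Real.exp (-(c * n * X ^ 2))) := by ring
            _ = _ := by rw [hVV, one_mul]
        · rw [norm_smul]
          exact (mul_le_of_le_one_left (norm_nonneg _) hV1).trans hmain
        · rw [norm_smul]
          refine (mul_le_of_le_one_left (norm_nonneg _) hV1).trans ?_
          rw [norm_smul, Complex.norm_real, Real.norm_of_nonneg (by positivity)]
          calc _ ≤ Real.exp (-(c * n * X ^ 2)) * (V * (K1 * X)) := by gcongr
            _ = _ := by ring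
        · calc _ ≤ Ca / n * Real.exp (-(ca * n * (c₀ * X ^ 2))) * ‖g z‖ := (hb n hn _).2
            _ ≤ Ca / n * Real.exp (-(c * n * X ^ 2)) * G :=
                mul_le_mul (mul_le_mul_of_nonneg_left (hExp n) (by positivity)) hgz
                  (norm_nonneg _) (by positivity)
            _ = _ := by rw [hA0]; ring
        · calc _ ≤ Real.exp (-(c * n * X ^ 2)) * (V * (KΩ * X * G)) :=
                (hpow n _).trans (by gcongr)
            _ = _ := by ring
    _ = (A1 * X + A3 * (n * X ^ 3) + A0 * (1 / n)) * Real.exp (-(c * n * X ^ 2)) := by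
        rw [hA1]; ring
    _ ≤ ((A1 + A3 + A0 + 1) * (X + n * X ^ 3 + 1 / n)) * Real.exp (-(c * n * X ^ 2)) := by
        gcongr
        have p1 : 0 ≤ n * X ^ 3 := by positivity
        have p2 : 0 ≤ 1 / (n : ℝ) := by positivity
        nlinarith [mul_nonneg hA10 p1, mul_nonneg hA10 p2, mul_nonneg hA30 hX0,
          mul_nonneg hA30 p2, mul_nonneg hA00 hX0, mul_nonneg hA00 p1]
    _ = (A1 + A3 + A0 + 1) * ((X + n * X ^ 3 + 1 / n) * Real.exp (-(c * n * X ^ 2))) := by ring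
    _ ≤ (A1 + A3 + A0 + 1) * ((3 + 16 / c ^ 2) / √n * Real.exp (-(c / 2 * n * X ^ 2))) := by
        exact mul_le_mul_of_nonneg_left (add_pow_three_mul_exp_le hc0 hn1 hX0) (by positivity)
    _ = _ := by ring

end Network

/-! ## The energy gap -/

section Gap

variable {ι E : Type*} [NormedAddCommGroup E] [InnerProductSpace ℝ E]

/-- The inner products with the vectors of a family. -/
def innerPi (b : ι → E) : E →ₗ[ℝ] (ι → ℝ) := LinearMap.pi fun j => innerₛₗ ℝ (b j)

theorem innerPi_apply (b : ι → E) (θ : E) (j : ι) : innerPi b θ j = ⟪b j, θ⟫_ℝ := rfl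

theorem exists_norm_le_mul_norm_innerPi [Fintype ι] [FiniteDimensional ℝ E] (b : Module.Basis ι ℝ E) :
    ∃ K : ℝ, 0 < K ∧ ∀ θ, ‖θ‖ ≤ K * ‖innerPi b θ‖ := by
  have hker : LinearMap.ker (innerPi (ι := ι) b) = ⊥ := by
    rw [LinearMap.ker_eq_bot']
    intro θ hθ
    refine InnerProductSpace.ext_inner_left_basis b fun j => ?_
    rw [← innerPi_apply, hθ]
    simp
  obtain ⟨K, hK, h⟩ := (innerPi (ι := ι) b).exists_antilipschitzWith hker
  refine ⟨K, by exact_mod_cast hK, fun θ => ?_⟩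
  have := h.le_mul_dist θ 0
  simpa [dist_eq_norm] using this

/-- The vectors which have inner products in `[-π, π]` with all vectors of a basis. -/
def dualCube (b : ι → E) : Set E := innerPi b ⁻¹' (Set.univ.pi fun _ => Set.Icc (-Real.pi) Real.pi)

theorem mem_dualCube {b : ι → E} {θ : E} : θ ∈ dualCube b ↔ ∀ j, |⟪b j, θ⟫_ℝ| ≤ Real.pi := by
  simp only [dualCube, Set.mem_preimage, Set.mem_univ_pi, Set.mem_Icc, innerPi_apply, abs_le]

theorem exists_norm_le_of_mem_dualCube [Fintype ι] [FiniteDimensional ℝ E] (b : Module.Basis ι ℝ E) :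
    ∃ R : ℝ, ∀ θ ∈ dualCube b, ‖θ‖ ≤ R := by
  obtain ⟨K, hK, h⟩ := exists_norm_le_mul_norm_innerPi b
  refine ⟨K * Real.pi, fun θ hθ => (h θ).trans ?_⟩
  gcongr
  exact (pi_norm_le_iff_of_nonneg Real.pi_pos.le).2 fun j => mem_dualCube.1 hθ j

theorem exists_le_norm_of_notMem_dualCube [Fintype ι] [FiniteDimensional ℝ E] (b : ι → E) :
    ∃ r : ℝ, 0 < r ∧ ∀ θ ∉ dualCube b, r ≤ ‖θ‖ := by
  obtain ⟨K, hK, h⟩ := exists_abs_apply_le (innerPi b)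
  refine ⟨Real.pi / K, div_pos Real.pi_pos hK, fun θ hθ => ?_⟩
  rw [mem_dualCube] at hθ
  push Not at hθ
  obtain ⟨j, hj⟩ := hθ
  rw [div_le_iff₀ hK, mul_comm]
  exact hj.le.trans (h θ j)

/-- The norm is `2 |sin (a/2)|`, so this is Jordan's inequality. The restriction to `[-π, π]` is the
reason for working on the dual cube. -/
theorem two_div_pi_mul_abs_le_norm {a : ℝ} (ha : |a| ≤ Real.pi) :
    2 / Real.pi * |a| ≤ ‖1 - Complex.exp (a * Complex.I)‖ := by
  rw [norm_sub_rev, mul_comm (a : ℂ), Complex.norm_exp_I_mul_ofReal_sub_one, norm_mul,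
    Real.norm_eq_abs, Real.norm_eq_abs]
  have := Real.mul_abs_le_abs_sin (x := a / 2) (by rw [abs_div, abs_two]; linarith)
  rw [abs_div, abs_two] at this
  rw [abs_two]
  linarith

namespace Network

variable {N : Network} (Ω : E →ₗ[ℝ] N.OneForm)

/-- The parallel transport along some path from `x` to `y` with total displacement `t` is
controlled by the energy. -/
def Transport (t : E) (x y : N.V) : Prop :=
  ∃ C : ℝ, 0 ≤ C ∧ ∀ θ f, ‖f x - Complex.exp (⟪θ, t⟫_ℝ * Complex.I) * f y‖
    ≤ C * √(N.energy (Ω θ) f)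

variable {Ω}

/-- Phases multiply along a concatenation of paths, and they are unimodular, so the errors add. -/
theorem Transport.trans {t s : E} {x y z : N.V} (ht : Transport Ω t x y)
    (hs : Transport Ω s y z) : Transport Ω (t + s) x z := by
  obtain ⟨C, hC, hb⟩ := ht
  obtain ⟨C', hC', hb'⟩ := hs
  refine ⟨C + C', by positivity, fun θ f => ?_⟩
  have h2 : f x - Complex.exp (⟪θ, t + s⟫_ℝ * Complex.I) * f z
      = (f x - Complex.exp (⟪θ, t⟫_ℝ * Complex.I) * f y)
        + Complex.exp (⟪θ, t⟫_ℝ * Complex.I) *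
          (f y - Complex.exp (⟪θ, s⟫_ℝ * Complex.I) * f z) := by
    rw [inner_add_right, Complex.ofReal_add, add_mul, Complex.exp_add]
    ring
  rw [h2, add_mul]
  refine (norm_add_le _ _).trans (add_le_add (hb θ f) ?_)
  rw [norm_mul, Complex.norm_exp_ofReal_mul_I, one_mul]
  exact hb' θ f

/-- The defect along one edge is a single term of the energy; hence the constant `√(2 / prob)`. -/
theorem Transport.of_edge {s : E} {e : N.E} (hs : ∀ θ, (Ω θ).1 e = ⟪θ, s⟫_ℝ) :
    Transport Ω s (N.org e) (N.ter e) := by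
  have hp : 0 < N.prob e := by
    have : Nonempty N.V := ⟨N.org e⟩
    exact mul_pos (N.c_pos e) (by exact_mod_cast Fintype.card_pos)
  refine ⟨√(2 / N.prob e), by positivity, fun θ f => ?_⟩
  rw [← Real.sqrt_mul (by positivity)]
  refine Real.le_sqrt_of_sq_le ?_
  rw [div_mul_eq_mul_div, le_div_iff₀ hp, energy, ← mul_assoc, mul_one_div_cancel two_ne_zero,
    one_mul, ← hs, mul_comm]
  exact Finset.single_le_sum (f := fun e => N.prob e *
      ‖f (N.org e) - Complex.exp ((Ω θ).1 e * Complex.I) * f (N.ter e)‖ ^ 2)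
    (fun e _ => mul_nonneg (N.prob_nonneg e) (by positivity)) (Finset.mem_univ e)

/-- At `θ = 0` all phases are 1, so zero energy forces equal values at the ends of every path. -/
theorem isConnected_of_transport (h : ∀ x y, ∃ t, Transport Ω t x y) : N.IsConnected := by
  intro f hf x y
  obtain ⟨t, C, -, hb⟩ := h x y
  have := hb 0 f
  rw [map_zero, hf] at this
  simpa [sub_eq_zero] using this

/-- Closed paths with displacements which form a basis yield a lower bound on the energy. -/
theorem exists_mul_le_energy [Fintype ι] [FiniteDimensional ℝ E] (b : Module.Basis ι ℝ E)
    (h : ∀ x j, Transport Ω (b j) x x) :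
    ∃ c : ℝ, 0 < c ∧ ∀ θ ∈ dualCube b, ∀ f, c * ‖θ‖ ^ 2 * ‖f‖ ^ 2 ≤ N.energy (Ω θ) f := by
  choose C hC hb using h
  obtain ⟨K, hK, hK'⟩ := exists_norm_le_mul_norm_innerPi b
  set S : ℝ := ∑ x, ∑ j, C x j with hS
  have hS0 : 0 ≤ S := Finset.sum_nonneg fun x _ => Finset.sum_nonneg fun j _ => hC x j
  have hCS : ∀ x j, C x j ≤ S := fun x j =>
    (Finset.single_le_sum (f := fun j => C x j) (fun j _ => hC x j) (Finset.mem_univ j)).trans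
      (Finset.single_le_sum (f := fun x => ∑ j, C x j)
        (fun x _ => Finset.sum_nonneg fun j _ => hC x j) (Finset.mem_univ x))
  set B : ℝ := Fintype.card N.V * (K * (Real.pi / 2 * S)) with hB
  have hB0 : 0 ≤ B := by have := Real.pi_pos; positivity
  refine ⟨1 / (B ^ 2 + 1), by positivity, fun θ hθ f => ?_⟩
  have hpt : ∀ x, ‖θ‖ * ‖f x‖ ≤ K * (Real.pi / 2 * S) * √(N.energy (Ω θ) f) := by
    intro x
    -- A closed path compares `f x` with a multiple of itself by the holonomy `exp (i⟨θ, b j⟩)`,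
    -- whose distance from 1 is at least `2/π · |⟨b j, θ⟩|`.
    have hj : ∀ j, |⟪b j, θ⟫_ℝ| * ‖f x‖ ≤ Real.pi / 2 * S * √(N.energy (Ω θ) f) := by
      intro j
      have h1 := hb x j θ f
      rw [← one_sub_mul, norm_mul, real_inner_comm] at h1
      have h2 := two_div_pi_mul_abs_le_norm (mem_dualCube.1 hθ j)
      calc |⟪b j, θ⟫_ℝ| * ‖f x‖
          = Real.pi / 2 * ((2 / Real.pi * |⟪b j, θ⟫_ℝ|) * ‖f x‖) := by
            have := Real.pi_pos.ne'
            field_simp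
        _ ≤ Real.pi / 2 * (S * √(N.energy (Ω θ) f)) := by
            have := Real.pi_pos
            refine mul_le_mul_of_nonneg_left ?_ (by positivity)
            refine (mul_le_mul_of_nonneg_right h2 (norm_nonneg _)).trans (h1.trans ?_)
            gcongr
            exact hCS x j
        _ = _ := by ring
    have hsup : ‖innerPi b θ‖ * ‖f x‖ ≤ Real.pi / 2 * S * √(N.energy (Ω θ) f) := by
      rw [mul_comm ‖innerPi b θ‖, ← norm_norm (f x), ← norm_smul, pi_norm_le_iff_of_nonneg
        (by have := Real.pi_pos; positivity)]
      intro j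
      rw [Pi.smul_apply, norm_smul, norm_norm, mul_comm]
      exact hj j
    calc ‖θ‖ * ‖f x‖ ≤ K * ‖innerPi b θ‖ * ‖f x‖ := by gcongr; exact hK' θ
      _ = K * (‖innerPi b θ‖ * ‖f x‖) := by ring
      _ ≤ K * (Real.pi / 2 * S * √(N.energy (Ω θ) f)) := by gcongr
      _ = _ := by ring
  have hall : ‖θ‖ * ‖f‖ ≤ B * √(N.energy (Ω θ) f) := by
    have := norm_le_card_mul (f := ((‖θ‖ : ℝ) : ℂ) • f)
      (B := K * (Real.pi / 2 * S) * √(N.energy (Ω θ) f))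
      (by have := Real.pi_pos; positivity) (fun x => by
        rw [PiLp.smul_apply, norm_smul, Complex.norm_real, norm_norm]
        exact hpt x)
    rw [norm_smul, Complex.norm_real, norm_norm] at this
    rw [hB]
    linarith
  have hsq : (‖θ‖ * ‖f‖) ^ 2 ≤ (B * √(N.energy (Ω θ) f)) ^ 2 := by gcongr
  rw [mul_pow, mul_pow, Real.sq_sqrt (N.energy_nonneg _ _)] at hsq
  rw [mul_assoc, one_div, inv_mul_le_iff₀ (by positivity)]
  nlinarith [N.energy_nonneg (Ω θ) f]

end Network
end Gap

/-! ## Fourier integrals -/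

section Fourier

open MeasureTheory

variable {ι : Type*} [Fintype ι]

/-- The matrix whose rows are the coordinates of a family of vectors. -/
def rowMatrix (b : ι → EuclideanSpace ℝ ι) : Matrix ι ι ℝ := Matrix.of fun j i => b j i

theorem innerPi_eq_toLin' [DecidableEq ι] (b : ι → EuclideanSpace ℝ ι) (θ : EuclideanSpace ℝ ι) :
    innerPi b θ = Matrix.toLin' (rowMatrix b) (WithLp.ofLp θ) := by
  ext j
  rw [innerPi_apply, PiLp.inner_apply, Matrix.toLin'_apply, Matrix.mulVec, dotProduct]
  refine Finset.sum_congr rfl fun i _ => ?_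
  simp [rowMatrix, mul_comm]

theorem rowMatrix_eq_toMatrix_transpose (b : ι → EuclideanSpace ℝ ι) :
    rowMatrix b = ((EuclideanSpace.basisFun ι ℝ).toBasis.toMatrix b).transpose := by
  ext j i
  simp [rowMatrix, Module.Basis.toMatrix_apply]

theorem det_rowMatrix_ne_zero [DecidableEq ι] (b : Module.Basis ι ℝ (EuclideanSpace ℝ ι)) :
    (rowMatrix b).det ≠ 0 := by
  rw [rowMatrix_eq_toMatrix_transpose, Matrix.det_transpose, ← Module.Basis.det_apply]
  exact (EuclideanSpace.basisFun ι ℝ).toBasis.isUnit_det b |>.ne_zero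

theorem map_innerPi_volume [DecidableEq ι] (b : Module.Basis ι ℝ (EuclideanSpace ℝ ι)) :
    Measure.map (innerPi b) volume
      = ENNReal.ofReal |(rowMatrix b).det⁻¹| • (volume : Measure (ι → ℝ)) := by
  have h : (innerPi (ι := ι) b : EuclideanSpace ℝ ι → ι → ℝ)
      = Matrix.toLin' (rowMatrix b) ∘ WithLp.ofLp := by
    ext1 θ
    exact innerPi_eq_toLin' b θ
  rw [h, ← Measure.map_map (LinearMap.continuous_of_finiteDimensional _).measurable
    (WithLp.measurable_ofLp 2 _), (PiLp.volume_preserving_ofLp ι).map_eq,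
    Real.map_matrix_volume_pi_eq_smul_volume_pi (det_rowMatrix_ne_zero b)]

theorem covolume_eq_abs_det_rowMatrix [DecidableEq ι] (L : Submodule ℤ (EuclideanSpace ℝ ι)) [DiscreteTopology L]
    [IsZLattice ℝ L] (b : Module.Basis ι ℤ L) :
    ZLattice.covolume L = |(rowMatrix fun j => (b j : EuclideanSpace ℝ ι)).det| := by
  rw [ZLattice.covolume_eq_det_mul_measureReal L (μ := volume) b (EuclideanSpace.basisFun ι ℝ).toBasis,
    measureReal_congr (ZSpan.fundamentalDomain_ae_parallelepiped _ _), measureReal_def,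
    OrthonormalBasis.coe_toBasis, OrthonormalBasis.volume_parallelepiped, ENNReal.toReal_one,
    mul_one, rowMatrix_eq_toMatrix_transpose, Matrix.det_transpose, Module.Basis.det_apply]
  rfl

theorem integral_Icc_exp_int_mul (k : ℤ) :
    ∫ a in Set.Icc (-Real.pi) Real.pi, Complex.exp (k * a * Complex.I)
      = if k = 0 then (2 * Real.pi : ℂ) else 0 := by
  have hpi := Real.pi_pos
  rw [integral_Icc_eq_integral_Ioc, ← intervalIntegral.integral_of_le (by linarith)]
  split_ifs with hk
  · subst hk
    simp
    ring
  · have hc : (k : ℂ) * Complex.I ≠ 0 := by simp [hk]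
    have e : ∀ a : ℝ, Complex.exp (k * a * Complex.I) = Complex.exp (k * Complex.I * a) :=
      fun a => by ring_nf
    simp only [e]
    rw [integral_exp_mul_complex hc, div_eq_zero_iff]
    left
    rw [sub_eq_zero, Complex.exp_eq_exp_iff_exists_int]
    refine ⟨k, ?_⟩
    push_cast
    ring

/-- In the coordinates `⟪b j, θ⟫` the dual cube is a product of intervals `[-π, π]`, and the
integrand is a product of characters of the circle. The Jacobian is `1 / |det|`. -/
theorem integral_dualCube_exp [DecidableEq ι] (b : Module.Basis ι ℝ (EuclideanSpace ℝ ι)) (k : ι → ℤ) :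
    ∫ θ in dualCube b, Complex.exp (⟪θ, ∑ j, k j • b j⟫_ℝ * Complex.I)
      = if k = 0 then (((2 * Real.pi) ^ Fintype.card ι / |(rowMatrix b).det| : ℝ) : ℂ) else 0 := by
  have hcont : Continuous (innerPi (ι := ι) b) := LinearMap.continuous_of_finiteDimensional _
  obtain ⟨φ, hφ⟩ : ∃ φ : (ι → ℝ) → ℂ, φ = fun α => ∏ j, Complex.exp (k j * α j * Complex.I) :=
    ⟨_, rfl⟩
  have hφc : Continuous φ := by rw [hφ]; fun_prop
  have e1 : ∀ θ, Complex.exp (⟪θ, ∑ j, k j • b j⟫_ℝ * Complex.I) = φ (innerPi b θ) := by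
    intro θ
    simp only [hφ, innerPi_apply]
    rw [← Complex.exp_sum, inner_sum]
    push_cast
    rw [Finset.sum_mul]
    congr 1
    refine Finset.sum_congr rfl fun j _ => ?_
    rw [← Int.cast_smul_eq_zsmul ℝ, inner_smul_right, real_inner_comm]
    push_cast
    rfl
  simp only [e1]
  rw [dualCube, ← setIntegral_map (MeasurableSet.univ_pi fun _ => measurableSet_Icc)
    hφc.aestronglyMeasurable hcont.aemeasurable, map_innerPi_volume, hφ,
    Measure.restrict_smul, integral_smul_measure, volume_pi, Measure.restrict_pi_pi,
    integral_fintype_prod_eq_prod fun j (a : ℝ) => Complex.exp (k j * a * Complex.I)]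
  simp only [integral_Icc_exp_int_mul]
  rw [ENNReal.toReal_ofReal (abs_nonneg _)]
  split_ifs with hk
  · simp [hk, abs_inv]
    ring
  · obtain ⟨j, hj⟩ := Function.ne_iff.1 hk
    rw [Finset.prod_eq_zero (Finset.mem_univ j) (if_neg hj), smul_zero]

theorem inner_toEuclideanLin_transpose [DecidableEq ι] (B : Matrix ι ι ℝ) (x y : EuclideanSpace ℝ ι) :
    ⟪Matrix.toEuclideanLin B.transpose x, y⟫_ℝ = ⟪x, Matrix.toEuclideanLin B y⟫_ℝ := by
  rw [← Matrix.conjTranspose_eq_transpose_of_trivial, Matrix.toEuclideanLin_conjTranspose_eq_adjoint,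
    LinearMap.adjoint_inner_left]

theorem toEuclideanLin_mul_apply [DecidableEq ι] (B C : Matrix ι ι ℝ) (x : EuclideanSpace ℝ ι) :
    Matrix.toEuclideanLin (B * C) x = Matrix.toEuclideanLin B (Matrix.toEuclideanLin C x) := by
  simp [Matrix.toLpLin_apply]

theorem det_toEuclideanLin [DecidableEq ι] (B : Matrix ι ι ℝ) :
    LinearMap.det (Matrix.toEuclideanLin B) = B.det := by
  rw [Matrix.toEuclideanLin_eq_toLin_orthonormal, LinearMap.det_toLin]

end Fourier

/-- Factor `S = BᵀB`. The substitution `β = Bθ` reduces the integral to the Fourier transform of the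
standard Gaussian at `w = B⁻ᵀ y`, and `‖w‖² = ⟨y, S⁻¹ y⟩`. -/
theorem integral_exp_inner_mul_gaussian {m : ℕ} {S : Matrix (Fin m) (Fin m) ℝ} (hS : S.PosDef)
    (y : EuclideanSpace ℝ (Fin m)) :
    ∫ θ : EuclideanSpace ℝ (Fin m), Complex.exp (-(⟪θ, y⟫_ℝ * Complex.I)) *
      (Real.exp (-(1 / 2 * ⟪θ, Matrix.toEuclideanLin S θ⟫_ℝ)) : ℂ)
      = (((2 * Real.pi) ^ m * gaussianDensity S y : ℝ) : ℂ) := by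
  open scoped MatrixOrder in
  obtain ⟨B, hB⟩ := CStarAlgebra.nonneg_iff_eq_star_mul_self.mp hS.posSemidef.nonneg
  rw [Matrix.star_eq_conjTranspose, Matrix.conjTranspose_eq_transpose_of_trivial] at hB
  have hdet : S.det = B.det ^ 2 := by rw [hB, Matrix.det_mul, Matrix.det_transpose, sq]
  have hB0 : B.det ≠ 0 := by
    intro h0
    have := hS.det_pos
    rw [hdet, h0] at this
    simp at this
  have hBu : IsUnit B.det := isUnit_iff_ne_zero.2 hB0
  set w := Matrix.toEuclideanLin B⁻¹.transpose y with hw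
  have hBw : Matrix.toEuclideanLin B.transpose w = y := by
    rw [hw, ← toEuclideanLin_mul_apply, ← Matrix.transpose_mul, Matrix.nonsing_inv_mul _ hBu,
      Matrix.transpose_one]
    simp
  have hwn : ‖w‖ ^ 2 = ⟪y, Matrix.toEuclideanLin S⁻¹ y⟫_ℝ := by
    rw [← real_inner_self_eq_norm_sq]
    conv_lhs => rw [hw, inner_toEuclideanLin_transpose, ← toEuclideanLin_mul_apply]
    rw [hB, Matrix.mul_inv_rev, Matrix.transpose_nonsing_inv]
  have hSθ : ∀ θ, ⟪θ, Matrix.toEuclideanLin S θ⟫_ℝ = ‖Matrix.toEuclideanLin B θ‖ ^ 2 := by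
    intro θ
    rw [hB, toEuclideanLin_mul_apply, real_inner_comm, inner_toEuclideanLin_transpose,
      real_inner_self_eq_norm_sq]
  have hyθ : ∀ θ, ⟪θ, y⟫_ℝ = ⟪w, Matrix.toEuclideanLin B θ⟫_ℝ := by
    intro θ
    rw [← inner_toEuclideanLin_transpose, hBw, real_inner_comm]
  obtain ⟨φ, hφ⟩ : ∃ φ : EuclideanSpace ℝ (Fin m) → ℂ,
      φ = fun β => Complex.exp (-(1 / 2 : ℂ) * ‖β‖ ^ 2 + (-Complex.I) * ⟪w, β⟫_ℝ) := ⟨_, rfl⟩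
  have hφc : Continuous φ := by rw [hφ]; fun_prop
  have hint : ∀ θ, Complex.exp (-(⟪θ, y⟫_ℝ * Complex.I)) *
      (Real.exp (-(1 / 2 * ⟪θ, Matrix.toEuclideanLin S θ⟫_ℝ)) : ℂ)
      = φ (Matrix.toEuclideanLin B θ) := by
    intro θ
    rw [hφ, hSθ, hyθ, Complex.ofReal_exp, ← Complex.exp_add]
    congr 1
    push_cast
    ring
  have hcont : Continuous (Matrix.toEuclideanLin B) := LinearMap.continuous_of_finiteDimensional _
  have hmap := MeasureTheory.Measure.map_linearMap_addHaar_eq_smul_addHaar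
    (μ := (MeasureTheory.volume : MeasureTheory.Measure (EuclideanSpace ℝ (Fin m))))
    (f := Matrix.toEuclideanLin B) (by rwa [det_toEuclideanLin])
  rw [det_toEuclideanLin] at hmap
  simp only [hint]
  rw [← MeasureTheory.integral_map hcont.aemeasurable
    hφc.aestronglyMeasurable, hmap, MeasureTheory.integral_smul_measure, hφ,
    GaussianFourier.integral_cexp_neg_mul_sq_norm_add (by norm_num) (-Complex.I) w,
    ENNReal.toReal_ofReal (abs_nonneg _), finrank_euclideanSpace_fin, gaussianDensity, hdet,
    Real.sqrt_sq_eq_abs, ← hwn]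
  have hpi : (Real.pi / (1 / 2) : ℂ) ^ (m / 2 : ℂ) = (((2 * Real.pi) ^ ((m : ℝ) / 2) : ℝ) : ℂ) := by
    rw [Complex.ofReal_cpow (by have := Real.pi_pos; positivity)]
    push_cast
    congr 1
    ring
  have hexp : Complex.exp ((-Complex.I) ^ 2 * ‖w‖ ^ 2 / (4 * (1 / 2)))
      = (Real.exp (-(1 / 2) * ‖w‖ ^ 2) : ℂ) := by
    rw [Complex.ofReal_exp]
    congr 1
    push_cast
    rw [neg_sq, Complex.I_sq]
    ring
  have h2pi : (2 * Real.pi) ^ m = (2 * Real.pi) ^ ((m : ℝ) / 2) * (2 * Real.pi) ^ ((m : ℝ) / 2) := by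
    rw [← Real.rpow_add (by have := Real.pi_pos; positivity), add_halves, Real.rpow_natCast]
  have hne : (2 * Real.pi) ^ ((m : ℝ) / 2) ≠ 0 := by have := Real.pi_pos; positivity
  have hd : |B.det| ≠ 0 := abs_ne_zero.2 hB0
  rw [hpi, hexp, h2pi, ← Complex.ofReal_mul, Complex.real_smul, ← Complex.ofReal_mul, abs_inv]
  congr 1
  field_simp

theorem integrable_exp_neg_mul_norm_sq {m : ℕ} {c : ℝ} (hc : 0 < c) :
    MeasureTheory.Integrable fun θ : EuclideanSpace ℝ (Fin m) => Real.exp (-(c * ‖θ‖ ^ 2)) := by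
  have := GaussianFourier.integrable_cexp_neg_mul_sq_norm_add (b := (c : ℂ)) (by simpa using hc) 0
    (0 : EuclideanSpace ℝ (Fin m))
  refine this.norm.congr (Filter.Eventually.of_forall fun θ => ?_)
  simp only [inner_zero_left, Complex.ofReal_zero, mul_zero, add_zero, Complex.norm_exp]
  congr 1
  norm_cast
  ring

/-! ## The random walk and the transition operators of the quotient network -/

section Averaging

variable {Γ : Type*} [Group Γ] (μ : PMF Γ) (hfin : μ.support.Finite)

/-- The transition operator of the random walk. -/
def average : (Γ → ℂ) →ₗ[ℂ] (Γ → ℂ) where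
  toFun G x := ∑ s ∈ hfin.toFinset, ((μ s).toReal : ℂ) * G (x * s)
  map_add' G H := by
    ext x
    simp [mul_add, Finset.sum_add_distrib]
  map_smul' r G := by
    ext x
    simp only [Pi.smul_apply, smul_eq_mul, RingHom.id_apply, Finset.mul_sum]
    exact Finset.sum_congr rfl fun s _ => by ring

theorem average_apply (G : Γ → ℂ) (x : Γ) :
    average μ hfin G x = ∑ s ∈ hfin.toFinset, ((μ s).toReal : ℂ) * G (x * s) := rfl

theorem convPow_succ_apply (n : ℕ) (x : Γ) :
    convPow μ (n + 1) x = ∑ s ∈ hfin.toFinset, μ s * convPow μ n (x * s⁻¹) := by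
  classical
  have hmap : ∀ y, (μ.map fun s => y * s) x = μ (y⁻¹ * x) := by
    intro y
    rw [PMF.map_apply, tsum_eq_single (y⁻¹ * x)]
    · simp
    · intro s hs
      rw [if_neg]
      rintro rfl
      simp at hs
  rw [convPow, PMF.bind_apply]
  simp only [hmap]
  rw [← ((Equiv.inv Γ).trans (Equiv.mulLeft x)).tsum_eq, tsum_eq_sum (s := hfin.toFinset)]
  · refine Finset.sum_congr rfl fun s _ => ?_
    simp [mul_comm]
  · intro s hs
    have : μ s = 0 := by simpa [PMF.mem_support_iff] using hs
    simp [this]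

open Classical in
-- Duality between laws and functions: averaging the indicator of `x` spreads it over the points `x
-- * s⁻¹`, as in the decomposition of the law by its last step.
theorem convPow_toReal_eq_average_pow (n : ℕ) (x : Γ) :
    ((convPow μ n x).toReal : ℂ) = (average μ hfin ^ n) (Pi.single x 1) 1 := by
  induction n generalizing x with
  | zero =>
    simp only [convPow, PMF.pure_apply, pow_zero, Module.End.one_apply, Pi.single_apply, eq_comm]
    split_ifs <;> simp
  | succ n ih =>
    have h : average μ hfin (Pi.single x 1)
        = ∑ s ∈ hfin.toFinset, ((μ s).toReal : ℂ) • (Pi.single (x * s⁻¹) 1 : Γ → ℂ) := by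
      ext y
      rw [average_apply, Finset.sum_apply]
      refine Finset.sum_congr rfl fun s _ => ?_
      simp [Pi.single_apply, eq_mul_inv_iff_mul_eq]
    rw [pow_succ, Module.End.mul_apply, h, map_sum, Finset.sum_apply, convPow_succ_apply μ hfin,
      ENNReal.toReal_sum fun s _ => ENNReal.mul_ne_top (μ.apply_ne_top s) (PMF.apply_ne_top _ _)]
    push_cast
    refine Finset.sum_congr rfl fun s _ => ?_
    rw [map_smul, Pi.smul_apply, ← ih, ENNReal.toReal_mul, smul_eq_mul]
    push_cast
    rfl

theorem average_pow_integral {X : Type*} [TopologicalSpace X] [MeasurableSpace X] [BorelSpace X]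
    [SecondCountableTopologyEither X ℂ] {ν : MeasureTheory.Measure X}
    [MeasureTheory.IsFiniteMeasureOnCompacts ν] {D : Set X} (hD : IsCompact D)
    (hDm : MeasurableSet D) (n : ℕ) {G : X → Γ → ℂ} (hG : ∀ g, Continuous fun θ => G θ g) (x : Γ) :
    (average μ hfin ^ n) (fun g => ∫ θ in D, G θ g ∂ν) x
      = ∫ θ in D, (average μ hfin ^ n) (G θ) x ∂ν := by
  induction n generalizing G with
  | zero => simp
  | succ n ih =>
    have h : average μ hfin (fun g => ∫ θ in D, G θ g ∂ν)
        = fun g => ∫ θ in D, average μ hfin (G θ) g ∂ν := by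
      ext g
      simp only [average_apply]
      rw [MeasureTheory.integral_finsetSum]
      · exact Finset.sum_congr rfl fun s _ => (MeasureTheory.integral_const_mul _ _).symm
      · exact fun s _ => (((hG _).continuousOn.integrableOn_compact' hD hDm)).const_mul _
    simp only [pow_succ, Module.End.mul_apply]
    rw [h, ih]
    intro g
    simp only [average_apply]
    exact continuous_finsetSum _ fun s _ => continuous_const.mul (hG _)

end Averaging

theorem sum_toReal_support {α : Type*} {μ : PMF α} {hfin : μ.support.Finite} :
    ∑ s ∈ hfin.toFinset, (μ s).toReal = 1 := by
  have h := μ.tsum_coe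
  rw [tsum_eq_sum (s := hfin.toFinset)] at h
  · rw [← ENNReal.toReal_sum fun s _ => μ.apply_ne_top s, h, ENNReal.toReal_one]
  · intro s hs
    simpa [PMF.mem_support_iff] using hs

section Quotient

variable {Γ : Type*} [Group Γ] {m : ℕ}
  {ρ : Γ →* (EuclideanSpace ℝ (Fin m) ≃ᵢ EuclideanSpace ℝ (Fin m))} {Λ : Subgroup Γ}

theorem orbitMap_one : orbitMap ρ 1 = 0 := by
  rw [orbitMap, map_one]
  rfl

theorem orbitMap_mul_of_mem (hΛ : ActsByTranslations ρ Λ) {g : Γ} (hg : g ∈ Λ) (h : Γ) :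
    orbitMap ρ (g * h) = orbitMap ρ h + orbitMap ρ g := by
  obtain ⟨t, ht⟩ := hΛ g hg
  have h0 : orbitMap ρ g = t := by rw [orbitMap, ht, zero_add]
  rw [h0, orbitMap, map_mul, IsometryEquiv.mul_apply, ht]
  rfl

variable [Λ.FiniteIndex] {μ : PMF Γ} {hfin : μ.support.Finite} {hsymm : ∀ s, μ s⁻¹ = μ s}

/-- The coset of a group element, as a vertex of the quotient network. -/
def vertex (Λ : Subgroup Γ) [Λ.FiniteIndex] (μ : PMF Γ) (hfin : μ.support.Finite)
    (hsymm : ∀ s, μ s⁻¹ = μ s) (g : Γ) : (quotientNetwork Λ μ hfin hsymm).V :=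
  (Quotient.mk _ g : Quotient (QuotientGroup.rightRel Λ))

theorem vertex_eq_iff {g h : Γ} :
    vertex Λ μ hfin hsymm g = vertex Λ μ hfin hsymm h ↔ h * g⁻¹ ∈ Λ := by
  change (Quotient.mk _ g : Quotient (QuotientGroup.rightRel Λ)) = Quotient.mk _ h ↔ _
  rw [Quotient.eq, QuotientGroup.rightRel_apply]

theorem vertex_surjective : Function.Surjective (vertex Λ μ hfin hsymm) := Quotient.mk_surjective

/-- The edge of the quotient network below the edge from `g` to `g * s`. -/
def edge (Λ : Subgroup Γ) [Λ.FiniteIndex] (μ : PMF Γ) (hfin : μ.support.Finite)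
    (hsymm : ∀ s, μ s⁻¹ = μ s) (g : Γ) (s : μ.support) : (quotientNetwork Λ μ hfin hsymm).E :=
  ((Quotient.mk _ g : Quotient (QuotientGroup.rightRel Λ)), s)

theorem ter_edge (g : Γ) (s : μ.support) :
    (quotientNetwork Λ μ hfin hsymm).ter (edge Λ μ hfin hsymm g s)
      = vertex Λ μ hfin hsymm (g * s) := rfl

theorem c_edge (g : Γ) (s : μ.support) :
    (quotientNetwork Λ μ hfin hsymm).c (edge Λ μ hfin hsymm g s)
      = (μ s).toReal / Λ.index := rfl

theorem card_quotientNetwork_V : Fintype.card (quotientNetwork Λ μ hfin hsymm).V = Λ.index := by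
  rw [Fintype.card_eq_nat_card, Subgroup.index]
  exact Nat.card_congr (QuotientGroup.quotientRightRelEquivQuotientLeftRel Λ)

theorem index_pos : (0 : ℝ) < Λ.index := by
  exact_mod_cast Nat.pos_of_ne_zero Subgroup.FiniteIndex.index_ne_zero

theorem prob_edge (g : Γ) (s : μ.support) :
    (quotientNetwork Λ μ hfin hsymm).prob (edge Λ μ hfin hsymm g s) = (μ s).toReal := by
  rw [Network.prob, c_edge, card_quotientNetwork_V, div_mul_cancel₀ _ index_pos.ne']

theorem sum_edgesFrom_vertex {R : Type*} [AddCommMonoid R] (g : Γ)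
    (G : (quotientNetwork Λ μ hfin hsymm).E → R) (H : Γ → R)
    (hGH : ∀ s : μ.support, G (edge Λ μ hfin hsymm g s) = H s) :
    ∑ e ∈ (quotientNetwork Λ μ hfin hsymm).edgesFrom (vertex Λ μ hfin hsymm g), G e
      = ∑ s ∈ hfin.toFinset, H s := by
  refine Finset.sum_bij' (fun e _ => (e.2 : Γ))
    (fun s hs => edge Λ μ hfin hsymm g ⟨s, hfin.mem_toFinset.1 hs⟩) ?_ ?_ ?_ ?_ ?_
  · rintro ⟨x, s⟩ _
    exact hfin.mem_toFinset.2 s.2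
  · intro s hs
    exact (Network.mem_edgesFrom _).2 rfl
  · rintro ⟨x, s⟩ he
    have : x = vertex Λ μ hfin hsymm g := (Network.mem_edgesFrom _).1 he
    subst this
    rfl
  · intro s hs
    rfl
  · rintro ⟨x, s⟩ he
    have : x = vertex Λ μ hfin hsymm g := (Network.mem_edgesFrom _).1 he
    subst this
    exact hGH s

theorem quotientNetwork_isUniform : (quotientNetwork Λ μ hfin hsymm).IsUniform := by
  intro x
  obtain ⟨g, rfl⟩ := vertex_surjective x
  rw [Network.vertexWeight, card_quotientNetwork_V,
    sum_edgesFrom_vertex g _ (fun s => (μ s).toReal / Λ.index) fun s => c_edge g s,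
    ← Finset.sum_div, sum_toReal_support, one_div]

theorem quotientNetwork_isLazy (hid : 0 < μ 1) :
    (quotientNetwork Λ μ hfin hsymm).IsLazy (μ 1).toReal := by
  intro x
  obtain ⟨g, rfl⟩ := vertex_surjective x
  refine ⟨edge Λ μ hfin hsymm g ⟨1, hid.ne'⟩, rfl, ?_,
    (prob_edge (hsymm := hsymm) g ⟨1, hid.ne'⟩).ge⟩
  refine Prod.ext ?_ ?_
  · exact congrArg (vertex Λ μ hfin hsymm) (mul_one g)
  · exact Subtype.ext inv_one

/-- The 1-forms `linearForm` as a linear function of the vector. -/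
def linearFormₗ (hΛ : ActsByTranslations ρ Λ) (μ : PMF Γ) (hfin : μ.support.Finite)
    (hsymm : ∀ s, μ s⁻¹ = μ s) :
    EuclideanSpace ℝ (Fin m) →ₗ[ℝ] (quotientNetwork Λ μ hfin hsymm).OneForm where
  toFun v := linearForm hΛ μ hfin hsymm v
  map_add' _ _ := Subtype.ext (funext fun _ => inner_add_left _ _ _)
  map_smul' _ _ := Subtype.ext (funext fun _ => real_inner_smul_left _ _ _)

theorem linearForm_edge (hΛ : ActsByTranslations ρ Λ) (v : EuclideanSpace ℝ (Fin m)) (g : Γ)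
    (s : μ.support) : (linearFormₗ hΛ μ hfin hsymm v).1 (edge Λ μ hfin hsymm g s)
      = ⟪v, orbitMap ρ (g * s) - orbitMap ρ g⟫_ℝ := rfl

/-- Floquet reduction: the quotient of the phases at `g * s` and at `g` is the exponential of the
1-form on the edge, which depends only on `s` and on the coset of `g`. -/
theorem average_exp_mul (hΛ : ActsByTranslations ρ Λ) (θ : EuclideanSpace ℝ (Fin m))
    (v : EuclideanSpace ℂ (quotientNetwork Λ μ hfin hsymm).V) :
    average μ hfin (fun g => Complex.exp (⟪θ, orbitMap ρ g⟫_ℝ * Complex.I) *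
      v (vertex Λ μ hfin hsymm g))
    = fun g => Complex.exp (⟪θ, orbitMap ρ g⟫_ℝ * Complex.I) *
      (quotientNetwork Λ μ hfin hsymm).transfer (linearFormₗ hΛ μ hfin hsymm θ) v
        (vertex Λ μ hfin hsymm g) := by
  ext g
  rw [average_apply, Network.transfer_apply, Finset.mul_sum]
  symm
  refine sum_edgesFrom_vertex g _ (fun s => ((μ s).toReal : ℂ) *
    (Complex.exp (⟪θ, orbitMap ρ (g * s)⟫_ℝ * Complex.I) * v (vertex Λ μ hfin hsymm (g * s))))
    fun s => ?_
  rw [prob_edge, linearForm_edge, ter_edge, inner_sub_right, Complex.ofReal_sub, sub_mul,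
    Complex.exp_sub]
  have := Complex.exp_ne_zero (⟪θ, orbitMap ρ g⟫_ℝ * Complex.I)
  field_simp

theorem average_pow_exp_mul (hΛ : ActsByTranslations ρ Λ) (θ : EuclideanSpace ℝ (Fin m)) (n : ℕ)
    (v : EuclideanSpace ℂ (quotientNetwork Λ μ hfin hsymm).V) :
    (average μ hfin ^ n) (fun g => Complex.exp (⟪θ, orbitMap ρ g⟫_ℝ * Complex.I) *
      v (vertex Λ μ hfin hsymm g))
    = fun g => Complex.exp (⟪θ, orbitMap ρ g⟫_ℝ * Complex.I) *
      ((quotientNetwork Λ μ hfin hsymm).transfer (linearFormₗ hΛ μ hfin hsymm θ) ^ n) v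
        (vertex Λ μ hfin hsymm g) := by
  induction n generalizing v with
  | zero => simp
  | succ n ih =>
    rw [pow_succ, Module.End.mul_apply, average_exp_mul hΛ, ih, pow_succ]
    rfl

theorem isCompact_dualCube (b : Module.Basis (Fin m) ℝ (EuclideanSpace ℝ (Fin m))) :
    IsCompact (dualCube b) := by
  obtain ⟨R, hR⟩ := exists_norm_le_of_mem_dualCube b
  refine Metric.isCompact_of_isClosed_isBounded ?_ (isBounded_iff_forall_norm_le.2 ⟨R, hR⟩)
  exact (isClosed_set_pi fun _ _ => isClosed_Icc).preimage
    (LinearMap.continuous_of_finiteDimensional (innerPi b))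

open Classical in
/-- Fourier inversion for the law of the random walk. -/
theorem convPow_toReal_eq_integral (hΛ : ActsByTranslations ρ Λ)
    (hinj : Function.Injective (orbitMap ρ))
    (b : Module.Basis (Fin m) ℝ (EuclideanSpace ℝ (Fin m)))
    (hb : ∀ g ∈ Λ, ∃ k : Fin m → ℤ, orbitMap ρ g = ∑ j, k j • b j) (n : ℕ) (x : Γ) :
    ((convPow μ n x).toReal : ℂ) = ((|(rowMatrix b).det| / (2 * Real.pi) ^ m : ℝ) : ℂ) *
      ∫ θ in dualCube b, Complex.exp (-(⟪θ, orbitMap ρ x⟫_ℝ * Complex.I)) *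
        ((quotientNetwork Λ μ hfin hsymm).transfer (linearFormₗ hΛ μ hfin hsymm θ) ^ n)
          (EuclideanSpace.single (vertex Λ μ hfin hsymm x) 1) (vertex Λ μ hfin hsymm 1) := by
  set G : EuclideanSpace ℝ (Fin m) → Γ → ℂ := fun θ =>
    Complex.exp (-(⟪θ, orbitMap ρ x⟫_ℝ * Complex.I)) •
      fun g => Complex.exp (⟪θ, orbitMap ρ g⟫_ℝ * Complex.I) *
        (EuclideanSpace.single (vertex Λ μ hfin hsymm x) (1 : ℂ)) (vertex Λ μ hfin hsymm g) with hG
  have hdet : |(rowMatrix b).det| ≠ 0 := abs_ne_zero.2 (det_rowMatrix_ne_zero b)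
  have hpi : (2 * Real.pi) ^ m ≠ 0 := by have := Real.pi_pos; positivity
  -- The indicator of the coset of `x`, multiplied by characters, integrates to the point mass at
  -- `x`: on this coset `Φ(g) - Φ(x)` is a lattice vector, which is zero only if `g = x`, by
  -- injectivity of `Φ`.
  have hsingle : (Pi.single x 1 : Γ → ℂ)
      = ((|(rowMatrix b).det| / (2 * Real.pi) ^ m : ℝ) : ℂ) • fun g => ∫ θ in dualCube b, G θ g := by
    ext g
    rw [Pi.smul_apply, smul_eq_mul]
    simp only [hG, Pi.smul_apply, smul_eq_mul]
    by_cases hgx : vertex Λ μ hfin hsymm g = vertex Λ μ hfin hsymm x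
    · obtain ⟨k, hk⟩ := hb _ (vertex_eq_iff.1 hgx.symm)
      have hgk : orbitMap ρ g - orbitMap ρ x = ∑ j, k j • b j := by
        rw [← hk, sub_eq_iff_eq_add', ← orbitMap_mul_of_mem hΛ (vertex_eq_iff.1 hgx.symm),
          inv_mul_cancel_right]
      have hk0 : k = 0 ↔ g = x := by
        constructor
        · rintro rfl
          apply hinj
          simpa [sub_eq_zero] using hgk
        · rintro rfl
          rw [sub_self] at hgk
          have hli := b.linearIndependent
          rw [Fintype.linearIndependent_iff] at hli
          have := hli (fun j => (k j : ℝ)) (by simpa only [Int.cast_smul_eq_zsmul] using hgk.symm)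
          ext j
          exact_mod_cast this j
      have hint : ∀ θ, Complex.exp (-(⟪θ, orbitMap ρ x⟫_ℝ * Complex.I)) *
          (Complex.exp (⟪θ, orbitMap ρ g⟫_ℝ * Complex.I) *
            (EuclideanSpace.single (vertex Λ μ hfin hsymm x) (1 : ℂ)) (vertex Λ μ hfin hsymm g))
          = Complex.exp (⟪θ, ∑ j, k j • b j⟫_ℝ * Complex.I) := by
        intro θ
        rw [hgx, ← hgk, inner_sub_right, ← mul_assoc, ← Complex.exp_add]
        simp only [PiLp.single_apply, if_true, mul_one]
        congr 1
        push_cast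
        ring
      simp only [hint]
      rw [integral_dualCube_exp, Fintype.card_fin]
      simp only [hk0, Pi.single_apply]
      split_ifs
      · rw [← Complex.ofReal_mul]
        norm_cast
        field_simp
      · simp
    · have hne : g ≠ x := fun h => hgx (by rw [h])
      simp [hgx, hne]
  have hGc : ∀ g, Continuous fun θ => G θ g := by
    intro g
    simp only [hG, Pi.smul_apply, smul_eq_mul]
    fun_prop
  rw [convPow_toReal_eq_average_pow μ hfin, hsingle, map_smul, Pi.smul_apply, smul_eq_mul,
    average_pow_integral μ hfin (isCompact_dualCube b) (isCompact_dualCube b).measurableSet n hGc]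
  congr 1
  refine MeasureTheory.integral_congr_ae (Filter.Eventually.of_forall fun θ => ?_)
  simp only [hG]
  rw [map_smul, average_pow_exp_mul hΛ, Pi.smul_apply, smul_eq_mul]
  simp [orbitMap_one]

end Quotient

/-! ## The geometry of the action -/

section Geometry

variable {Γ : Type*} [Group Γ] {m : ℕ}
  {ρ : Γ →* (EuclideanSpace ℝ (Fin m) ≃ᵢ EuclideanSpace ℝ (Fin m))}
  {F : Set (EuclideanSpace ℝ (Fin m))} {Λ : Subgroup Γ}

/-- Take a ball of radius `r` about 0 inside the interior of `F`. If two orbit points were closer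
than `r`, one of them would lie in both translates of the interior. -/
theorem IsFundamentalDomain.exists_le_dist_orbitMap (hF : IsFundamentalDomain ρ F)
    (hF0 : (0 : EuclideanSpace ℝ (Fin m)) ∈ interior F) :
    ∃ r : ℝ, 0 < r ∧ ∀ g h, g ≠ h → r ≤ dist (orbitMap ρ g) (orbitMap ρ h) := by
  obtain ⟨r, hr, hball⟩ := Metric.isOpen_iff.1 isOpen_interior 0 hF0
  refine ⟨r, hr, fun g h hgh => ?_⟩
  by_contra! hlt
  refine Set.disjoint_left.1 (hF.disjoint g h hgh) (Set.mem_image_of_mem _ hF0) ?_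
  refine ⟨(ρ h).symm (ρ g 0), hball ?_, (ρ h).apply_symm_apply _⟩
  rw [Metric.mem_ball, ← (ρ h).isometry.dist_eq, (ρ h).apply_symm_apply]
  exact hlt

theorem IsFundamentalDomain.orbitMap_injective (hF : IsFundamentalDomain ρ F)
    (hF0 : (0 : EuclideanSpace ℝ (Fin m)) ∈ interior F) : Function.Injective (orbitMap ρ) := by
  obtain ⟨r, hr, h⟩ := hF.exists_le_dist_orbitMap hF0
  intro g g' hgg
  by_contra hne
  have := h g g' hne
  rw [hgg, dist_self] at this
  linarith

/-- The orbit of `Λ` is cobounded: the translates of the bounded set `closure F` cover, and up to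
translations from `Λ` only finitely many group elements occur. -/
theorem IsFundamentalDomain.exists_norm_sub_orbitMap_le (hF : IsFundamentalDomain ρ F)
    (hFc : IsCompact (closure F)) [Λ.FiniteIndex] (hΛ : ActsByTranslations ρ Λ) :
    ∃ R : ℝ, ∀ v, ∃ g ∈ Λ, ‖v - orbitMap ρ g‖ ≤ R := by
  have : Finite (Quotient (QuotientGroup.rightRel Λ)) :=
    Finite.of_equiv _ (QuotientGroup.quotientRightRelEquivQuotientLeftRel Λ).symm
  obtain ⟨R₁, hR₁⟩ := (Set.finite_range fun q : Quotient (QuotientGroup.rightRel Λ) =>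
    ‖orbitMap ρ q.out‖).bddAbove
  obtain ⟨R₂, hR₂⟩ := isBounded_iff_forall_norm_le.1 hFc.isBounded
  refine ⟨R₂ + R₁, fun v => ?_⟩
  have hv : v ∈ ⋃ g, ρ g '' closure F := hF.covers ▸ Set.mem_univ v
  obtain ⟨g, y, hy, rfl⟩ := Set.mem_iUnion.1 hv
  set q : Quotient (QuotientGroup.rightRel Λ) := Quotient.mk _ g with hq
  have hmem : g * q.out⁻¹ ∈ Λ := by
    rw [← QuotientGroup.rightRel_apply, ← Quotient.eq, Quotient.out_eq]
  refine ⟨g * q.out⁻¹, hmem, ?_⟩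
  obtain ⟨t, ht⟩ := hΛ _ hmem
  have h1 : ρ g y = ρ q.out y + t := by
    rw [← ht, ← IsometryEquiv.mul_apply, ← map_mul, inv_mul_cancel_right]
  have h2 : orbitMap ρ (g * q.out⁻¹) = t := by rw [orbitMap, ht, zero_add]
  rw [h1, h2, add_sub_cancel_right]
  calc ‖ρ q.out y‖ = ‖(ρ q.out y - ρ q.out 0) + orbitMap ρ q.out‖ := by rw [orbitMap]; simp
    _ ≤ ‖ρ q.out y - ρ q.out 0‖ + ‖orbitMap ρ q.out‖ := norm_add_le _ _
    _ ≤ R₂ + R₁ := by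
        gcongr
        · rw [← dist_eq_norm, (ρ q.out).isometry.dist_eq, dist_zero_right]
          exact hR₂ y hy
        · exact hR₁ ⟨q, rfl⟩

/-- If the orbit of `Λ` lies in the hyperplane orthogonal to `v ≠ 0`, the distance of `k v` from it
grows without bound, against coboundedness. -/
theorem IsFundamentalDomain.eq_zero_of_forall_inner_eq_zero (hF : IsFundamentalDomain ρ F)
    (hFc : IsCompact (closure F)) [Λ.FiniteIndex] (hΛ : ActsByTranslations ρ Λ)
    {v : EuclideanSpace ℝ (Fin m)} (hv : ∀ g ∈ Λ, ⟪v, orbitMap ρ g⟫_ℝ = 0) : v = 0 := by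
  obtain ⟨R, hR⟩ := hF.exists_norm_sub_orbitMap_le hFc hΛ
  by_contra hne
  have hpos : 0 < ‖v‖ := norm_pos_iff.2 hne
  obtain ⟨k, hk⟩ := exists_nat_gt (R / ‖v‖)
  rw [div_lt_iff₀ hpos] at hk
  obtain ⟨g, hg, hgR⟩ := hR ((k : ℝ) • v)
  have h1 : ⟪v, (k : ℝ) • v - orbitMap ρ g⟫_ℝ = k * ‖v‖ ^ 2 := by
    rw [inner_sub_right, hv g hg, inner_smul_right, real_inner_self_eq_norm_sq, sub_zero]
  have h2 := real_inner_le_norm v ((k : ℝ) • v - orbitMap ρ g)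
  rw [h1] at h2
  have h3 : ‖v‖ * ‖(k : ℝ) • v - orbitMap ρ g‖ ≤ ‖v‖ * R := by gcongr
  nlinarith

theorem mem_translationLattice_iff (hΛ : ActsByTranslations ρ Λ) {v : EuclideanSpace ℝ (Fin m)} :
    v ∈ translationLattice ρ Λ ↔ ∃ g ∈ Λ, orbitMap ρ g = v := by
  refine ⟨fun hv => ?_, fun ⟨g, hg, h⟩ => Submodule.subset_span ⟨g, hg, h⟩⟩
  have hinv : ∀ g ∈ Λ, orbitMap ρ g⁻¹ = -orbitMap ρ g := by
    intro g hg
    have := orbitMap_mul_of_mem hΛ hg g⁻¹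
    rw [mul_inv_cancel, orbitMap_one] at this
    exact eq_neg_of_add_eq_zero_left this.symm
  rw [translationLattice, ← Submodule.mem_toAddSubgroup,
    Submodule.span_int_eq_addSubgroupClosure] at hv
  induction hv using AddSubgroup.closure_induction with
  | mem v hv => exact hv
  | zero => exact ⟨1, Λ.one_mem, orbitMap_one⟩
  | add v w _ _ hv hw =>
    obtain ⟨g, hg, rfl⟩ := hv
    obtain ⟨h, hh, rfl⟩ := hw
    exact ⟨h * g, Λ.mul_mem hh hg, orbitMap_mul_of_mem hΛ hh g⟩
  | neg v _ hv =>
    obtain ⟨g, hg, rfl⟩ := hv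
    exact ⟨g⁻¹, Λ.inv_mem hg, hinv g hg⟩

theorem IsFundamentalDomain.discreteTopology (hF : IsFundamentalDomain ρ F)
    (hF0 : (0 : EuclideanSpace ℝ (Fin m)) ∈ interior F) (hΛ : ActsByTranslations ρ Λ) :
    DiscreteTopology (translationLattice ρ Λ) := by
  obtain ⟨r, hr, h⟩ := hF.exists_le_dist_orbitMap hF0
  refine DiscreteTopology.of_forall_le_dist hr ?_
  rintro ⟨v, hv⟩ ⟨w, hw⟩ hne
  obtain ⟨g, -, rfl⟩ := (mem_translationLattice_iff hΛ).1 hv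
  obtain ⟨g', -, rfl⟩ := (mem_translationLattice_iff hΛ).1 hw
  exact h g g' fun hgg => hne (by subst hgg; rfl)

theorem IsFundamentalDomain.isZLattice (hF : IsFundamentalDomain ρ F)
    (hFc : IsCompact (closure F)) [Λ.FiniteIndex] (hΛ : ActsByTranslations ρ Λ)
    [DiscreteTopology (translationLattice ρ Λ)] : IsZLattice ℝ (translationLattice ρ Λ) := by
  refine ⟨?_⟩
  rw [← Submodule.orthogonal_eq_bot_iff, Submodule.eq_bot_iff]
  intro v hv
  refine hF.eq_zero_of_forall_inner_eq_zero hFc hΛ fun g hg => ?_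
  rw [real_inner_comm]
  exact (Submodule.mem_orthogonal _ _).1 hv _ (Submodule.subset_span
    ((mem_translationLattice_iff hΛ).2 ⟨g, hg, rfl⟩))

/-- The translation lattice has a basis, whose determinant is the covolume. -/
theorem IsFundamentalDomain.exists_basis (hF : IsFundamentalDomain ρ F)
    (hFc : IsCompact (closure F)) (hF0 : (0 : EuclideanSpace ℝ (Fin m)) ∈ interior F)
    [Λ.FiniteIndex] (hΛ : ActsByTranslations ρ Λ) :
    ∃ b : Module.Basis (Fin m) ℝ (EuclideanSpace ℝ (Fin m)),
      (∀ g ∈ Λ, ∃ k : Fin m → ℤ, orbitMap ρ g = ∑ j, k j • b j) ∧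
      (∀ j, ∃ g ∈ Λ, orbitMap ρ g = b j) ∧
      ZLattice.covolume (translationLattice ρ Λ) = |(rowMatrix b).det| := by
  have := hF.discreteTopology hF0 hΛ
  have := hF.isZLattice hFc hΛ
  have : Module.Finite ℤ (translationLattice ρ Λ) := ZLattice.module_finite ℝ _
  have : Module.Free ℤ (translationLattice ρ Λ) := ZLattice.module_free ℝ _
  let c : Module.Basis (Fin m) ℤ (translationLattice ρ Λ) :=
    Module.finBasisOfFinrankEq _ _ (by rw [ZLattice.rank ℝ, finrank_euclideanSpace_fin])
  have hc : ∀ j, c.ofZLatticeBasis ℝ (translationLattice ρ Λ) j = c j :=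
    fun j => c.ofZLatticeBasis_apply ℝ _ j
  refine ⟨c.ofZLatticeBasis ℝ (translationLattice ρ Λ), fun g hg => ?_, fun j => ?_, ?_⟩
  · set v : translationLattice ρ Λ :=
      ⟨orbitMap ρ g, (mem_translationLattice_iff hΛ).2 ⟨g, hg, rfl⟩⟩ with hv
    refine ⟨fun j => c.repr v j, ?_⟩
    simp only [hc]
    calc orbitMap ρ g = ((∑ j, c.repr v j • c j : translationLattice ρ Λ) :
          EuclideanSpace ℝ (Fin m)) := by rw [c.sum_repr v]
      _ = _ := by simp only [Submodule.coe_sum, Submodule.coe_smul]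
  · rw [hc]
    exact (mem_translationLattice_iff hΛ).1 (c j).2
  · rw [covolume_eq_abs_det_rowMatrix _ c]
    congr 2
    exact congrArg rowMatrix (funext fun j => (hc j).symm)

end Geometry

/-! ## The harmonic parts and the covariance matrix -/

namespace Network

variable {N : Network}

theorem harmonicPart_eq {ω u : N.OneForm} (h : N.IsHarmonicPart ω u) : N.harmonicPart ω = u :=
  (N.existsUnique_isHarmonicPart ω).unique (N.harmonicPart_spec ω) h

variable (N) in
/-- The harmonic part as a linear map. -/
def harmonicPartₗ : N.OneForm →ₗ[ℝ] N.OneForm where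
  toFun := N.harmonicPart
  map_add' a b := by
    obtain ⟨ha, f, hf⟩ := N.harmonicPart_spec a
    obtain ⟨hb, g, hg⟩ := N.harmonicPart_spec b
    refine harmonicPart_eq ⟨?_, f + g, ?_⟩
    · rw [dStar_eq_zero_iff] at ha hb ⊢
      intro φ
      rw [map_add, ha, hb, add_zero]
    · rw [map_add, add_add_add_comm, hf, hg]
  map_smul' r a := by
    obtain ⟨ha, f, hf⟩ := N.harmonicPart_spec a
    refine harmonicPart_eq ⟨?_, r • f, ?_⟩
    · rw [dStar_eq_zero_iff] at ha ⊢
      intro φ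
      rw [RingHom.id_apply, map_smul, ha, smul_zero]
    · rw [map_smul, RingHom.id_apply, ← smul_add, hf]

/-- The potentials of the exact parts of a linear family of 1-forms can be chosen linearly. -/
theorem exists_harmonicPart_add_d_eq {ι E : Type*} [AddCommGroup E] [Module ℝ E]
    (b : Module.Basis ι ℝ E) (Ω : E →ₗ[ℝ] N.OneForm) :
    ∃ f : E →ₗ[ℝ] (N.V → ℝ), ∀ θ, N.harmonicPart (Ω θ) + N.d (f θ) = Ω θ := by
  choose φ hφ using fun i => (N.harmonicPart_spec (Ω (b i))).2
  -- A potential is not determined by its differential, so potentials are chosen on a basis and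
  -- extended linearly.
  refine ⟨b.constr ℝ φ, fun θ => ?_⟩
  have : N.harmonicPartₗ ∘ₗ Ω + N.d ∘ₗ b.constr ℝ φ = Ω := by
    refine b.ext fun i => ?_
    simp only [LinearMap.add_apply, LinearMap.comp_apply, Module.Basis.constr_basis]
    exact hφ i
  exact LinearMap.congr_fun this θ

/-- The Gram matrix of a family of 1-forms. -/
def gram {m : ℕ} (U : EuclideanSpace ℝ (Fin m) →ₗ[ℝ] N.OneForm) : Matrix (Fin m) (Fin m) ℝ :=
  Matrix.of fun i j => ∑ e, (U (EuclideanSpace.single i 1)).1 e *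
    (U (EuclideanSpace.single j 1)).1 e * N.c e

theorem inner_toEuclideanLin_gram {m : ℕ} (U : EuclideanSpace ℝ (Fin m) →ₗ[ℝ] N.OneForm)
    (v w : EuclideanSpace ℝ (Fin m)) :
    ⟪v, Matrix.toEuclideanLin (gram U) w⟫_ℝ = ∑ e, (U v).1 e * (U w).1 e * N.c e := by
  have hU : ∀ (v : EuclideanSpace ℝ (Fin m)) (e : N.E),
      (U v).1 e = ∑ i, v i * (U (EuclideanSpace.single i 1)).1 e := by
    intro v e
    have hv : v = ∑ i, v i • EuclideanSpace.single i (1 : ℝ) := by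
      ext j
      simp [Pi.single_apply]
    conv_lhs => rw [hv, map_sum]
    simp
  have hcomm : ∑ e, (U v).1 e * (U w).1 e * N.c e = ∑ e, (U w).1 e * (U v).1 e * N.c e :=
    Finset.sum_congr rfl fun e _ => by ring
  rw [PiLp.inner_apply, hcomm]
  simp only [hU v, hU w, Finset.mul_sum, Finset.sum_mul]
  rw [Finset.sum_comm]
  refine Finset.sum_congr rfl fun i _ => ?_
  rw [Finset.sum_comm]
  simp only [Matrix.toLpLin_apply, Matrix.mulVec, dotProduct, gram, Matrix.of_apply,
    RCLike.inner_apply, conj_trivial, Finset.sum_mul]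
  refine Finset.sum_congr rfl fun j _ => Finset.sum_congr rfl fun e _ => ?_
  ring

theorem gram_posDef {m : ℕ} {U : EuclideanSpace ℝ (Fin m) →ₗ[ℝ] N.OneForm}
    (hU : ∀ v, U v = 0 → v = 0) : (gram U).PosDef := by
  refine Matrix.PosDef.of_dotProduct_mulVec_pos ?_ fun x hx => ?_
  · ext i j
    simp [gram, mul_comm]
  · have h := inner_toEuclideanLin_gram U (WithLp.toLp 2 x) (WithLp.toLp 2 x)
    have h' : dotProduct (star x) ((gram U).mulVec x)
        = ⟪WithLp.toLp 2 x, Matrix.toEuclideanLin (gram U) (WithLp.toLp 2 x)⟫_ℝ := by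
      rw [PiLp.inner_apply, dotProduct]
      exact Finset.sum_congr rfl fun i _ => by simp [mul_comm]
    rw [h', h]
    refine lt_of_le_of_ne (Finset.sum_nonneg fun e _ =>
      mul_nonneg (mul_self_nonneg _) (N.c_pos e).le) fun h0 => hx ?_
    have : U (WithLp.toLp 2 x) = 0 := by
      refine N.form_self_eq_zero ?_
      rw [form_apply, ← h0, mul_zero]
    simpa using hU _ this

/-- Quantitative positivity of the covariance form: an injective linear map on a finite-dimensional
space is bounded below. It gives the Gaussian decay of `exp (-nq)`. -/
theorem exists_mul_norm_sq_le_sum {E : Type*} [NormedAddCommGroup E] [NormedSpace ℝ E]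
    [FiniteDimensional ℝ E] {U : E →ₗ[ℝ] N.OneForm} (hU : ∀ v, U v = 0 → v = 0) :
    ∃ c : ℝ, 0 < c ∧ ∀ θ, c * ‖θ‖ ^ 2 ≤ ∑ e, (U θ).1 e ^ 2 * N.c e := by
  have hker : LinearMap.ker (N.OneForm.subtype ∘ₗ U) = ⊥ := by
    rw [LinearMap.ker_eq_bot']
    intro θ hθ
    exact hU θ (Subtype.ext hθ)
  obtain ⟨K, hK, h⟩ := (N.OneForm.subtype ∘ₗ U).exists_antilipschitzWith hker
  have hK' : (0 : ℝ) < K := by exact_mod_cast hK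
  set S : ℝ := ∑ e, (N.c e)⁻¹ with hS
  have hS0 : 0 ≤ S := Finset.sum_nonneg fun e _ => (inv_pos.2 (N.c_pos e)).le
  refine ⟨(K ^ 2 * S + 1)⁻¹, by positivity, fun θ => ?_⟩
  set Q : ℝ := ∑ e, (U θ).1 e ^ 2 * N.c e with hQ
  have hQ0 : 0 ≤ Q := Finset.sum_nonneg fun e _ => mul_nonneg (sq_nonneg _) (N.c_pos e).le
  have h1 : ‖θ‖ ≤ K * ‖(U θ).1‖ := by
    have := h.le_mul_dist θ 0
    simpa [dist_eq_norm] using this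
  have h2 : ‖(U θ).1‖ ≤ √(Q * S) := by
    refine (pi_norm_le_iff_of_nonneg (Real.sqrt_nonneg _)).2 fun e => Real.le_sqrt_of_sq_le ?_
    rw [Real.norm_eq_abs, sq_abs]
    have hc := N.c_pos e
    calc (U θ).1 e ^ 2 = ((U θ).1 e ^ 2 * N.c e) * (N.c e)⁻¹ := by field_simp
      _ ≤ Q * S := by
        gcongr
        · exact Finset.single_le_sum (f := fun e => (U θ).1 e ^ 2 * N.c e)
            (fun e _ => mul_nonneg (sq_nonneg _) (N.c_pos e).le) (Finset.mem_univ e)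
        · exact Finset.single_le_sum (f := fun e => (N.c e)⁻¹)
            (fun e _ => (inv_pos.2 (N.c_pos e)).le) (Finset.mem_univ e)
  have h3 : ‖θ‖ ^ 2 ≤ K ^ 2 * (Q * S) := by
    calc ‖θ‖ ^ 2 ≤ (K * √(Q * S)) ^ 2 := by gcongr; exact h1.trans (by gcongr)
      _ = _ := by rw [mul_pow, Real.sq_sqrt (by positivity)]
  rw [inv_mul_le_iff₀ (by positivity)]
  nlinarith

end Network

section Quotient

variable {Γ : Type*} [Group Γ] {m : ℕ}
  {ρ : Γ →* (EuclideanSpace ℝ (Fin m) ≃ᵢ EuclideanSpace ℝ (Fin m))} {Λ : Subgroup Γ}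
  [Λ.FiniteIndex] {μ : PMF Γ} {hfin : μ.support.Finite} {hsymm : ∀ s, μ s⁻¹ = μ s}

/-- A word for `g` in the support of `μ` is a path from `x` to `x * g`, along which the
displacements telescope. -/
theorem transport_vertex (hΛ : ActsByTranslations ρ Λ)
    (hgen : Subsemigroup.closure μ.support = ⊤) (x g : Γ) :
    Network.Transport (linearFormₗ hΛ μ hfin hsymm) (orbitMap ρ (x * g) - orbitMap ρ x)
      (vertex Λ μ hfin hsymm x) (vertex Λ μ hfin hsymm (x * g)) := by
  have hg : g ∈ Subsemigroup.closure μ.support := hgen ▸ Subsemigroup.mem_top g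
  induction hg using Subsemigroup.closure_induction generalizing x with
  | mem s hs =>
    exact Network.Transport.of_edge (e := edge Λ μ hfin hsymm x ⟨s, hs⟩)
      fun θ => linearForm_edge hΛ θ x ⟨s, hs⟩
  | mul s t _ _ ihs iht =>
    have := (ihs x).trans (iht (x * s))
    rwa [mul_assoc, add_comm, sub_add_sub_cancel] at this

/-- The harmonic parts of the 1-forms `linearForm`. -/
def harmonicForm (hΛ : ActsByTranslations ρ Λ) (μ : PMF Γ) (hfin : μ.support.Finite)
    (hsymm : ∀ s, μ s⁻¹ = μ s) :
    EuclideanSpace ℝ (Fin m) →ₗ[ℝ] (quotientNetwork Λ μ hfin hsymm).OneForm :=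
  (quotientNetwork Λ μ hfin hsymm).harmonicPartₗ ∘ₗ linearFormₗ hΛ μ hfin hsymm

/-- A form with zero harmonic part is exact. Then `⟨v, Φ⟩` is, up to a constant, the pullback of a
function on the quotient, so it vanishes on `Λ`, whose orbit is cobounded. -/
theorem IsFundamentalDomain.eq_zero_of_harmonicForm_eq_zero {F : Set (EuclideanSpace ℝ (Fin m))}
    (hF : IsFundamentalDomain ρ F) (hFc : IsCompact (closure F)) (hΛ : ActsByTranslations ρ Λ)
    (hgen : Subsemigroup.closure μ.support = ⊤) {v : EuclideanSpace ℝ (Fin m)}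
    (hv : harmonicForm hΛ μ hfin hsymm v = 0) : v = 0 := by
  obtain ⟨-, f, hf⟩ := (quotientNetwork Λ μ hfin hsymm).harmonicPart_spec
    (linearFormₗ hΛ μ hfin hsymm v)
  have hv' : (quotientNetwork Λ μ hfin hsymm).harmonicPart (linearFormₗ hΛ μ hfin hsymm v) = 0 := hv
  rw [hv', zero_add] at hf
  have key : ∀ g x, ⟪v, orbitMap ρ (x * g) - orbitMap ρ x⟫_ℝ
      = f (vertex Λ μ hfin hsymm (x * g)) - f (vertex Λ μ hfin hsymm x) := by
    intro g
    have hg : g ∈ Subsemigroup.closure μ.support := hgen ▸ Subsemigroup.mem_top g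
    induction hg using Subsemigroup.closure_induction with
    | mem s hs =>
      intro x
      rw [← linearForm_edge (hfin := hfin) (hsymm := hsymm) hΛ v x ⟨s, hs⟩, ← hf]
      rfl
    | mul s t _ _ ihs iht =>
      intro x
      have h1 := ihs x
      have h2 := iht (x * s)
      rw [mul_assoc] at h2
      rw [← sub_add_sub_cancel _ (orbitMap ρ (x * s)), inner_add_right, h1, h2]
      ring
  refine hF.eq_zero_of_forall_inner_eq_zero hFc hΛ fun g hg => ?_
  have := key g 1
  rw [one_mul, orbitMap_one, sub_zero] at this
  rw [this, sub_eq_zero]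
  congr 1
  rw [vertex_eq_iff, one_mul]
  exact Λ.inv_mem hg

end Quotient

/-! ### Integration of the Gaussian bounds. -/

section LocalLimit

open MeasureTheory

variable {m : ℕ}

theorem integral_exp_neg_mul_norm_sq {c : ℝ} (hc : 0 < c) :
    ∫ θ : EuclideanSpace ℝ (Fin m), Real.exp (-(c * ‖θ‖ ^ 2)) = (Real.pi / c) ^ ((m : ℝ) / 2) := by
  have := GaussianFourier.integral_rexp_neg_mul_sq_norm (V := EuclideanSpace ℝ (Fin m)) hc
  rw [finrank_euclideanSpace_fin] at this
  simpa only [neg_mul] using this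

/-- A Gaussian is negligible outside of a neighbourhood of the origin. -/
theorem exp_neg_mul_sq_le_of_le {c r : ℝ} (hc : 0 < c) (hr : 0 < r) {n : ℝ} (hn : 1 ≤ n) {X : ℝ}
    (hX : r ≤ X) : Real.exp (-(c * n * X ^ 2))
      ≤ ((3 + 16 / c ^ 2) / r) / √n * Real.exp (-(c / 2 * n * X ^ 2)) := by
  have hX0 : 0 ≤ X := hr.le.trans hX
  have h1 := add_pow_three_mul_exp_le hc hn hX0
  have h2 : 0 ≤ n * X ^ 3 + 1 / n := by positivity
  calc Real.exp (-(c * n * X ^ 2)) = 1 / r * (r * Real.exp (-(c * n * X ^ 2))) := by field_simp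
    _ ≤ 1 / r * ((X + n * X ^ 3 + 1 / n) * Real.exp (-(c * n * X ^ 2))) := by gcongr; linarith
    _ ≤ 1 / r * ((3 + 16 / c ^ 2) / √n * Real.exp (-(c / 2 * n * X ^ 2))) := by gcongr 1 / r * ?_
    _ = _ := by ring

/-- The source of the exponent `(m+1)/2`: `1/2` from the pointwise error, `m/2` from the volume
under the Gaussian. -/
theorem one_div_sqrt_mul_rpow {c n : ℝ} (hc : 0 < c) (hn : 0 < n) :
    1 / √n * (Real.pi / (c * n)) ^ ((m : ℝ) / 2)
      = (Real.pi / c) ^ ((m : ℝ) / 2) / n ^ (((m : ℝ) + 1) / 2) := by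
  have hpi := Real.pi_pos
  rw [← div_div, Real.div_rpow (by positivity) hn.le, add_div, Real.rpow_add hn,
    Real.sqrt_eq_rpow]
  field_simp

/-- Comparison of the integral of a function over a set `D` with a Gaussian integral. -/
theorem norm_setIntegral_sub_integral_le {D : Set (EuclideanSpace ℝ (Fin m))} (hD : IsCompact D)
    {f g : EuclideanSpace ℝ (Fin m) → ℂ} (hf : Continuous f)
    {B c : ℝ} (hc : 0 < c)
    (hfg : ∀ θ ∈ D, ‖f θ - g θ‖ ≤ B * Real.exp (-(c * ‖θ‖ ^ 2)))
    (hgD : ∀ θ ∉ D, ‖g θ‖ ≤ B * Real.exp (-(c * ‖θ‖ ^ 2))) (hgi : Integrable g) :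
    ‖(∫ θ in D, f θ) - ∫ θ, g θ‖ ≤ B * (Real.pi / c) ^ ((m : ℝ) / 2) := by
  have hDm := hD.measurableSet
  rw [← integral_indicator hDm, ← integral_sub
    ((integrable_indicator_iff hDm).2 (hf.continuousOn.integrableOn_compact hD)) hgi,
    ← integral_exp_neg_mul_norm_sq hc, ← integral_const_mul]
  refine norm_integral_le_of_norm_le ((integrable_exp_neg_mul_norm_sq hc).const_mul B)
    (Filter.Eventually.of_forall fun θ => ?_)
  by_cases hθ : θ ∈ D
  · rw [Set.indicator_of_mem hθ]
    exact hfg θ hθ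
  · rw [Set.indicator_of_notMem hθ, zero_sub, norm_neg]
    exact hgD θ hθ

end LocalLimit

theorem Network.continuous_transfer_pow {N : Network} {E : Type*} [NormedAddCommGroup E]
    [InnerProductSpace ℝ E] [FiniteDimensional ℝ E] (Ω : E →ₗ[ℝ] N.OneForm) (n : ℕ)
    {v : E → EuclideanSpace ℂ N.V} (hv : ∀ x, Continuous fun θ => v θ x) (x : N.V) :
    Continuous fun θ => (N.transfer (Ω θ) ^ n) (v θ) x := by
  induction n generalizing v with
  | zero => simpa using hv x
  | succ n ih =>
    simp only [pow_succ, Module.End.mul_apply]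
    refine ih fun y => ?_
    simp only [transfer_apply]
    refine continuous_finsetSum _ fun e _ => continuous_const.mul (Continuous.mul ?_ (hv _))
    have hc : Continuous fun θ => (Ω θ).1 e :=
      (continuous_apply e).comp
        (LinearMap.continuous_of_finiteDimensional (N.OneForm.subtype ∘ₗ Ω))
    fun_prop

/-! ### Characteristic functions of the walk. -/

section Main

variable {Γ : Type*} [Group Γ] {m : ℕ}
  {ρ : Γ →* (EuclideanSpace ℝ (Fin m) ≃ᵢ EuclideanSpace ℝ (Fin m))} {Λ : Subgroup Γ}
  {F : Set (EuclideanSpace ℝ (Fin m))}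
  [Λ.FiniteIndex] {μ : PMF Γ} {hfin : μ.support.Finite} {hsymm : ∀ s, μ s⁻¹ = μ s}

open Classical in
/-- The Gaussian approximation of the characteristic functions of the random walk. -/
theorem IsFundamentalDomain.exists_norm_transfer_pow_sub_le (hF : IsFundamentalDomain ρ F)
    (hFc : IsCompact (closure F)) (hΛ : ActsByTranslations ρ Λ)
    (hgen : Subsemigroup.closure μ.support = ⊤) (hid : 0 < μ 1)
    (b : Module.Basis (Fin m) ℝ (EuclideanSpace ℝ (Fin m)))
    (hb : ∀ j, ∃ g ∈ Λ, orbitMap ρ g = b j) :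
    ∃ C c : ℝ, 0 < C ∧ 0 < c ∧ ∀ θ ∈ dualCube b, ∀ n : ℕ, 0 < n → ∀ x z,
      ‖((quotientNetwork Λ μ hfin hsymm).transfer (linearFormₗ hΛ μ hfin hsymm θ) ^ n)
          (EuclideanSpace.single z 1) x
        - (((Λ.index : ℝ)⁻¹ * Real.exp (-(1 / 2 * ⟪θ, Matrix.toEuclideanLin
          ((n : ℝ) • Network.gram (harmonicForm hΛ μ hfin hsymm)) θ⟫_ℝ)) : ℝ) : ℂ)‖
      ≤ C / √n * Real.exp (-(c * n * ‖θ‖ ^ 2)) := by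
  set N := quotientNetwork Λ μ hfin hsymm with hN
  have hne : Nonempty N.V := ⟨vertex Λ μ hfin hsymm 1⟩
  obtain ⟨f, hf⟩ := Network.exists_harmonicPart_add_d_eq b (linearFormₗ hΛ μ hfin hsymm)
  have htr := transport_vertex (hfin := hfin) (hsymm := hsymm) hΛ hgen
  have hconn : N.IsConnected := by
    refine Network.isConnected_of_transport (Ω := linearFormₗ hΛ μ hfin hsymm) fun x y => ?_
    obtain ⟨g, rfl⟩ := vertex_surjective x
    obtain ⟨h, rfl⟩ := vertex_surjective y
    have := htr g (g⁻¹ * h)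
    rw [mul_inv_cancel_left] at this
    exact ⟨_, this⟩
  -- For `t ∈ Λ` with orbit point `b j`, a path from `g` to `t * g` closes up in the quotient, and
  -- its displacement is the translation vector of `t`, whatever `g` is.
  have hloop : ∀ x j, Network.Transport (linearFormₗ hΛ μ hfin hsymm) (b j) x x := by
    intro x j
    obtain ⟨g, rfl⟩ := vertex_surjective x
    obtain ⟨t, ht, htb⟩ := hb j
    have := htr g (g⁻¹ * (t * g))
    rw [mul_inv_cancel_left, orbitMap_mul_of_mem hΛ ht, add_sub_cancel_left, htb] at this
    have hv : vertex Λ μ hfin hsymm (t * g) = vertex Λ μ hfin hsymm g := by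
      rw [vertex_eq_iff, mul_inv_rev, mul_inv_cancel_left]
      exact Λ.inv_mem ht
    rwa [hv] at this
  obtain ⟨R, hR⟩ := exists_norm_le_of_mem_dualCube b
  obtain ⟨c₀, hc₀, hgap⟩ := Network.exists_mul_le_energy b hloop
  obtain ⟨c₁, hc₁, hpos⟩ := Network.exists_mul_norm_sq_le_sum
    (U := harmonicForm hΛ μ hfin hsymm)
    fun v hv => hF.eq_zero_of_harmonicForm_eq_zero hFc hΛ hgen hv
  obtain ⟨C, c, hC, hc, h⟩ := quotientNetwork_isUniform.norm_transfer_pow_single_sub_le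
    (ENNReal.toReal_pos hid.ne' (μ.apply_ne_top 1)) (quotientNetwork_isLazy hid) hconn
    (linearFormₗ hΛ μ hfin hsymm) (harmonicForm hΛ μ hfin hsymm) f hf
    (fun θ => (N.harmonicPart_spec _).1) hR hc₀ hc₁ hgap hpos
  refine ⟨C, c, hC, hc, fun θ hθ n hn x z => ?_⟩
  have := h θ hθ n hn x z
  rw [card_quotientNetwork_V] at this
  have he : 1 / 2 * ⟪θ, Matrix.toEuclideanLin
      ((n : ℝ) • Network.gram (harmonicForm hΛ μ hfin hsymm)) θ⟫_ℝ
      = n * (1 / 2 * ∑ e, (harmonicForm hΛ μ hfin hsymm θ).1 e ^ 2 * N.c e) := by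
    rw [map_smul, LinearMap.smul_apply, inner_smul_right, Network.inner_toEuclideanLin_gram]
    simp only [sq]
    ring
  rw [he]
  exact this

end Main

end LatticeWalk

end

/-! ### Proof of the local central limit theorem. -/

open LatticeWalk in
theorem theorem3p4 {Γ : Type*} [Group Γ] {m : ℕ}
    (ρ : Γ →* (EuclideanSpace ℝ (Fin m) ≃ᵢ EuclideanSpace ℝ (Fin m)))
    (F : Set (EuclideanSpace ℝ (Fin m)))
    (hF : LatticeWalk.IsFundamentalDomain ρ F)
    (hFc : IsCompact (closure F))
    (hF0 : (0 : EuclideanSpace ℝ (Fin m)) ∈ interior F)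
    (Λ : Subgroup Γ) [Λ.FiniteIndex]
    (hΛ : LatticeWalk.ActsByTranslations ρ Λ)
    (μ : PMF Γ)
    (hfin : μ.support.Finite)
    (hgen : Subsemigroup.closure μ.support = ⊤)
    (hsymm : ∀ s, μ s⁻¹ = μ s)
    (hid : 0 < μ 1) :
    ∃ A : Matrix (Fin m) (Fin m) ℝ, A.PosDef ∧
      (∃ C : ℝ, 0 < C ∧ ∀ n : ℕ, 0 < n → ∀ x : Γ,
        |(LatticeWalk.convPow μ n x).toReal -
            ZLattice.covolume (LatticeWalk.translationLattice ρ Λ) / (Λ.index : ℝ) *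
              LatticeWalk.gaussianDensity ((n : ℝ) • A) (LatticeWalk.orbitMap ρ x)|
          ≤ C / (n : ℝ) ^ (((m : ℝ) + 1) / 2)) ∧
      ∀ v₁ v₂ : EuclideanSpace ℝ (Fin m),
        inner ℝ v₁ (Matrix.toEuclideanLin A v₂) =
          ∑ e : (LatticeWalk.quotientNetwork Λ μ hfin hsymm).E,
            ((LatticeWalk.quotientNetwork Λ μ hfin hsymm).harmonicPart
                (LatticeWalk.linearForm hΛ μ hfin hsymm v₁)).1 e *
              ((LatticeWalk.quotientNetwork Λ μ hfin hsymm).harmonicPart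
                (LatticeWalk.linearForm hΛ μ hfin hsymm v₂)).1 e *
              (LatticeWalk.quotientNetwork Λ μ hfin hsymm).c e := by
  classical
  have hU : ∀ v, harmonicForm hΛ μ hfin hsymm v = 0 → v = 0 :=
    fun v hv => hF.eq_zero_of_harmonicForm_eq_zero hFc hΛ hgen hv
  have hA := Network.gram_posDef hU
  refine ⟨Network.gram (harmonicForm hΛ μ hfin hsymm), hA, ?_,
    fun v₁ v₂ => Network.inner_toEuclideanLin_gram _ v₁ v₂⟩
  set A := Network.gram (harmonicForm hΛ μ hfin hsymm) with hAdef
  obtain ⟨b, hb1, hb2, hcov⟩ := hF.exists_basis hFc hF0 hΛ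
  obtain ⟨C, c, hC, hc, happrox⟩ := hF.exists_norm_transfer_pow_sub_le (hfin := hfin)
    (hsymm := hsymm) hFc hΛ hgen hid b hb2
  obtain ⟨r, hr, hrD⟩ := exists_le_norm_of_notMem_dualCube (b : Fin m → EuclideanSpace ℝ (Fin m))
  obtain ⟨c₁, hc₁, hpos⟩ := Network.exists_mul_norm_sq_le_sum hU
  have hquad : ∀ (n : ℕ) θ, 1 / 2 * c₁ * n * ‖θ‖ ^ 2
      ≤ 1 / 2 * ⟪θ, Matrix.toEuclideanLin ((n : ℝ) • A) θ⟫_ℝ := by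
    intro n θ
    rw [map_smul, LinearMap.smul_apply, inner_smul_right, Network.inner_toEuclideanLin_gram]
    have h1 := hpos θ
    simp only [← sq]
    calc 1 / 2 * c₁ * n * ‖θ‖ ^ 2 = 1 / 2 * (n * (c₁ * ‖θ‖ ^ 2)) := by ring
      _ ≤ _ := by gcongr
  -- The normalization in Fourier inversion. Its `(2π)^m` cancels that of the Gaussian integral,
  -- which leaves covolume over index.
  set κ : ℝ := |(rowMatrix b).det| / (2 * Real.pi) ^ m with hκ
  have hκ0 : 0 < κ := by
    have := Real.pi_pos
    have := abs_pos.2 (det_rowMatrix_ne_zero b)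
    positivity
  have hindex : (1 : ℝ) ≤ Λ.index := by
    exact_mod_cast Nat.one_le_iff_ne_zero.2 Subgroup.FiniteIndex.index_ne_zero
  -- a common bound for the two error terms
  set K : ℝ := C + (3 + 16 / (1 / 2 * c₁) ^ 2) / r with hK
  set c' : ℝ := min c (1 / 2 * c₁ / 2) with hc'
  have hc'0 : 0 < c' := by positivity
  have hK0 : 0 < K := by positivity
  have hpi := Real.pi_pos
  refine ⟨κ * (K * (Real.pi / c') ^ ((m : ℝ) / 2)), by positivity, fun n hn x => ?_⟩
  have hn1 : (1 : ℝ) ≤ n := by exact_mod_cast hn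
  have hn0 : (0 : ℝ) < n := by linarith
  set S := (n : ℝ) • A with hS
  have hSpos : S.PosDef := hA.smul hn0
  set f : EuclideanSpace ℝ (Fin m) → ℂ := fun θ =>
    Complex.exp (-(⟪θ, orbitMap ρ x⟫_ℝ * Complex.I)) *
      ((quotientNetwork Λ μ hfin hsymm).transfer (linearFormₗ hΛ μ hfin hsymm θ) ^ n)
        (EuclideanSpace.single (vertex Λ μ hfin hsymm x) 1) (vertex Λ μ hfin hsymm 1) with hf
  set g : EuclideanSpace ℝ (Fin m) → ℂ := fun θ =>
    Complex.exp (-(⟪θ, orbitMap ρ x⟫_ℝ * Complex.I)) *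
      (((Λ.index : ℝ)⁻¹ * Real.exp (-(1 / 2 * ⟪θ, Matrix.toEuclideanLin S θ⟫_ℝ)) : ℝ) : ℂ) with hg
  have hnexp : ∀ θ, ‖Complex.exp (-(⟪θ, orbitMap ρ x⟫_ℝ * Complex.I))‖ = 1 := by
    intro θ
    rw [← neg_mul, ← Complex.ofReal_neg, Complex.norm_exp_ofReal_mul_I]
  have hfc : Continuous f := by
    refine Continuous.mul (by fun_prop) ?_
    exact Network.continuous_transfer_pow _ n (fun y => continuous_const) _
  have hSc : Continuous (Matrix.toEuclideanLin S) := LinearMap.continuous_of_finiteDimensional _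
  have hgc : Continuous g := by
    refine Continuous.mul (by fun_prop) (Complex.continuous_ofReal.comp ?_)
    fun_prop
  have hgn : ∀ θ, ‖g θ‖ ≤ Real.exp (-(1 / 2 * c₁ * n * ‖θ‖ ^ 2)) := by
    intro θ
    rw [hg, norm_mul, hnexp, one_mul, Complex.norm_real, Real.norm_of_nonneg (by positivity)]
    refine (mul_le_of_le_one_left (Real.exp_pos _).le (inv_le_one_of_one_le₀ hindex)).trans ?_
    rw [Real.exp_le_exp, neg_le_neg_iff]
    exact hquad n θ
  have hgi : MeasureTheory.Integrable g :=
    (integrable_exp_neg_mul_norm_sq (c := 1 / 2 * c₁ * n) (by positivity)).mono'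
      hgc.aestronglyMeasurable (Filter.Eventually.of_forall hgn)
  have hle : ∀ {L d : ℝ}, 0 ≤ L → L ≤ K → c' ≤ d → ∀ θ : EuclideanSpace ℝ (Fin m),
      L / √n * Real.exp (-(d * n * ‖θ‖ ^ 2)) ≤ K / √n * Real.exp (-(c' * n * ‖θ‖ ^ 2)) := by
    intro L d hL hLK hd θ
    gcongr
  -- On the dual cube the integrands differ by the operator error. Off the cube only the Gaussian is
  -- left, and it is negligible because `‖θ‖ ≥ r` there.
  have hdiff := norm_setIntegral_sub_integral_le (isCompact_dualCube b) hfc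
    (B := K / √n) (c := c' * n) (by positivity)
    (fun θ hθ => by
      rw [hf, hg, ← mul_sub, norm_mul, hnexp, one_mul]
      refine (happrox θ hθ n hn _ _).trans (hle hC.le ?_ (min_le_left _ _) θ)
      rw [hK]
      linarith [show 0 < (3 + 16 / (1 / 2 * c₁) ^ 2) / r by positivity])
    (fun θ hθ => by
      refine (hgn θ).trans ((exp_neg_mul_sq_le_of_le (by positivity) hr hn1 (hrD θ hθ)).trans
        (hle (by positivity) ?_ (min_le_right _ _) θ))
      rw [hK]
      linarith) hgi
  have hint : ∫ θ, g θ = (((Λ.index : ℝ)⁻¹ * ((2 * Real.pi) ^ m *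
      gaussianDensity S (orbitMap ρ x)) : ℝ) : ℂ) := by
    rw [Complex.ofReal_mul, ← integral_exp_inner_mul_gaussian hSpos, ←
      MeasureTheory.integral_const_mul]
    refine MeasureTheory.integral_congr_ae (Filter.Eventually.of_forall fun θ => ?_)
    simp only [hg]
    push_cast
    ring
  have hmain : (((convPow μ n x).toReal - ZLattice.covolume (translationLattice ρ Λ) /
      (Λ.index : ℝ) * gaussianDensity S (orbitMap ρ x) : ℝ) : ℂ)
      = (κ : ℂ) * ((∫ θ in dualCube b, f θ) - ∫ θ, g θ) := by
    rw [Complex.ofReal_sub, convPow_toReal_eq_integral (hfin := hfin) (hsymm := hsymm) hΛ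
      (hF.orbitMap_injective hF0) b hb1, mul_sub, hint, ← Complex.ofReal_mul, hcov]
    congr 2
    rw [hκ]
    have : (2 * Real.pi) ^ m ≠ 0 := by positivity
    field_simp
  rw [← Real.norm_eq_abs, ← Complex.norm_real, hmain, norm_mul, Complex.norm_real,
    Real.norm_of_nonneg hκ0.le]
  calc κ * ‖(∫ θ in dualCube b, f θ) - ∫ θ, g θ‖
      ≤ κ * (K / √n * (Real.pi / (c' * n)) ^ ((m : ℝ) / 2)) := by gcongr
    _ = κ * (K * (1 / √n * (Real.pi / (c' * n)) ^ ((m : ℝ) / 2))) := by ring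
    _ = _ := by
        rw [one_div_sqrt_mul_rpow hc'0 hn0]
        ring
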